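/- Let $d\ge 2$ and let $V:\mathbb R^d\to\mathbb R$ be a fixed integrable interaction whose negative part $V^-$ is in $L^\infty$, with $V(-x)=V(x)$, $V(x)=0$ for $|x|>a$, and $V$ isotropic ($V(x)$ depends only on $|x|$). For $L>2a$ regard $V$ as a function on the torus $\mathbb T_L^d$ of side $L$ (extend it $L$-periodically) and put $\hat V_L(k)=\int_{\mathbb T_L^d}V(x)e^{-ik\cdot x}\,dx$ for $k\in\frac{2\pi}{L}\mathbb Z^d$. Suppose that for some $L_0>2a$ the coefficient $\hat V_{L_0}(k)$ is negative for some $k$. For probability densities $\rho$ on $\mathbb T_L^d$ let $\rho_0=L^{-d}$ be the uniform density, $$\mathcal S(\rho)=\int\rho\log\rho\,dx,\quad \mathcal E(\rho,\rho)=\iint V(x-y)\rho(x)\rho(y)\,dx\,dy,\quad \mathcal F_\theta(\rho)=\mathcal S(\rho)+\tfrac12\theta L^d\,\mathcal E(\rho,\rho)\in(-\infty,+\infty],$$ and let $F_\theta=\inf_\rho\mathcal F_\theta(\rho)$, let $\mathscr M_\theta$ be the set of minimizers of $\mathcal F_\theta$, and let $S_\theta=\inf_{\mathscr M_\theta}\mathcal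 S(\rho)$ and $E_\theta=\inf_{\mathscr M_\theta}\tfrac12\theta L^d\mathcal E(\rho,\rho)$. Densities are identified when they agree almost everywhere. A number $\theta_c\ge0$ is a *(lower) critical point* if (i) for $0\le\theta\le\theta_c$, $\rho_0$ is the unique minimizer of $\mathcal F_\theta$; (ii) for every $\theta>\theta_c$ there is a minimizer $\rho_\theta\ne\rho_0$ of $\mathcal F_\theta$; (iii) for every family $(\rho_\theta)_{\theta>\theta_c}$ of such minimizers, $\limsup_{\theta\downarrow\theta_c}\|\rho_0-\rho_\theta\|_1=0$. A number $\theta_0>0$ is a *lower transition point* if $\rho_0$ is the unique minimizer of $\mathcal F_\theta$ for $0\le\theta<\theta_0$ and for every $\theta>\theta_0$ there is a minimizer $\rho_\theta\ne\rho_0$; it is a *discontinuous transition* if it is not a critical point. Then there is $L_1$ such that for every $L\ge L_1$ (with $L>0$) there is no (lower) critical point on $\mathbb T_L^d$. Instead there is a discontinuous transition at some $\theta_T$ with the following properties. 1. $\hat V_L$ attains its minimum over $\frac{2\pi}{L}\mathbb Z^d$ at some $k^\sharp$, $\hat V_L(k^\sharp)<0$, and $\theta_T<\theta^\sharp:=|\hat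 V_L(k^\sharp)|^{-1}$. 2. For no family $(\rho_\theta)_{\theta>\theta_T}$ of minimizers $\rho_\theta\neq\rho_0$ of $\mathcal F_\theta$ does $\|\rho_0-\rho_\theta\|_1\to0$ as $\theta\downarrow\theta_T$. 3. (Phase coexistence.) There is $\rho_{\theta_T}\ne\rho_0$ such that both $\rho_0$ and $\rho_{\theta_T}$ minimize $\mathcal F_{\theta_T}$, that is, $\mathcal F_{\theta_T}(\rho_{\theta_T})=\mathcal F_{\theta_T}(\rho_0)=F_{\theta_T}$, while $\mathcal E(\rho_{\theta_T},\rho_{\theta_T})<\mathcal E(\rho_0,\rho_0)$ and $\mathcal S(\rho_{\theta_T})>\mathcal S(\rho_0)$. 4. Both $\theta\mapsto E_\theta$ and $\theta\mapsto S_\theta$ are discontinuous at $\theta_T$. -/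

import Mathlib

open MeasureTheory Filter Topology

namespace McKeanVlasov

noncomputable section

/-- The class `𝒱` of interactions: `V ∈ L¹`, negative part in `L^∞`, symmetric, finite range `a`. -/
structure IsInteraction {d : ℕ} (a : ℝ) (V : EuclideanSpace ℝ (Fin d) → ℝ) : Prop where
  integrable : Integrable V volume
  negPart_bounded : MemLp (fun x => max (-V x) 0) ⊤ volume
  symmetric : ∀ x, V (-x) = V x
  finite_range : ∀ x, a < ‖x‖ → V x = 0

/-- `V(x)` depends only on the Euclidean length `|x|`. -/
def IsIsotropic {d : ℕ} (V : EuclideanSpace ℝ (Fin d) → ℝ) : Prop :=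
  ∀ x y, ‖x‖ = ‖y‖ → V x = V y

/-- The `d`-dimensional torus of side `L`; its `volume` is Lebesgue measure, of total mass `L ^ d`. -/
abbrev Torus (d : ℕ) (L : ℝ) : Type := Fin d → AddCircle L

section

variable {d : ℕ} {L : ℝ} [Fact (0 < L)]

/-- The interaction `V`, as a function on the torus: `V` is evaluated at the representative in
the centred cube `[-L/2, L/2)^d`. For `L > 2 a` that cube contains the range of `V`, so that this
is the periodization of `V`. -/
def torusPotential (L : ℝ) [Fact (0 < L)] (V : EuclideanSpace ℝ (Fin d) → ℝ) :
    Torus d L → ℝ :=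
  fun x => V (WithLp.toLp 2 fun i => (AddCircle.equivIco L (-(L / 2)) (x i) : ℝ))

/-- The Fourier coefficient `∫ W(x) exp(-i k·x) dx` over the torus, at the wave vector
`k = (2π/L) n`, `n ∈ ℤ^d`. The integral is real for symmetric `W`; its real part is taken to
have a real-valued function. -/
def fourierCoefficient (W : Torus d L → ℝ) (n : Fin d → ℤ) : ℝ :=
  (∫ x : Torus d L, (W x : ℂ) * ∏ i, fourier (-(n i)) (x i)).re

/-- Not of positive type: some Fourier coefficient on the torus is negative. -/
def HasNegativeMode (W : Torus d L → ℝ) : Prop :=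
  ∃ n : Fin d → ℤ, fourierCoefficient W n < 0

/-- The index `n ∈ ℤ^d` of a wave vector `k^♯` that minimizes the Fourier coefficient. -/
def IsMinimizingMode (W : Torus d L → ℝ) (n : Fin d → ℤ) : Prop :=
  ∀ m : Fin d → ℤ, fourierCoefficient W n ≤ fourierCoefficient W m

/-- The class `𝒫` of probability densities on the torus. -/
structure IsDensity (ρ : Torus d L → ℝ) : Prop where
  integrable : Integrable ρ volume
  nonneg : 0 ≤ᵐ[volume] ρ
  integral_eq_one : ∫ x, ρ x = 1

/-- The uniform density `ρ₀ = L ^ (-d)`. -/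
def uniformDensity (d : ℕ) (L : ℝ) : Torus d L → ℝ :=
  fun _ => (L ^ d)⁻¹

/-- `𝒮(ρ) = ∫ ρ log ρ`. -/
def entropy (ρ : Torus d L → ℝ) : ℝ :=
  ∫ x, ρ x * Real.log (ρ x)

/-- `ℰ(ρ, σ) = ∫∫ W(x - y) ρ(x) σ(y) dx dy`. -/
def energy (W ρ σ : Torus d L → ℝ) : ℝ :=
  ∫ p : Torus d L × Torus d L, W (p.1 - p.2) * ρ p.1 * σ p.2

/-- The free energy functional
`ℱ_θ(ρ) = ∫ ρ log ρ + (θ / 2) L ^ d ∫∫ W(x - y) ρ(x) ρ(y) dx dy`. -/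
def freeEnergy (W : Torus d L → ℝ) (θ : ℝ) (ρ : Torus d L → ℝ) : ℝ :=
  entropy ρ + 1 / 2 * θ * L ^ d * energy W ρ ρ

/-- The probability densities with finite entropy and energy. Both integrands have integrable
negative parts when `ρ` is a density and `W` is bounded below, so for all other densities
one of the two integrals is `+∞`; such densities compete in no minimization. -/
structure IsAdmissible (W ρ : Torus d L → ℝ) : Prop where
  isDensity : IsDensity ρ
  entropy_finite : Integrable (fun x => ρ x * Real.log (ρ x)) volume
  energy_finite : Integrable
    (fun p : Torus d L × Torus d L => W (p.1 - p.2) * ρ p.1 * ρ p.2) volume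

/-- `ρ ∈ ℳ_θ`: the density `ρ` minimizes `ℱ_θ` (densities of infinite free energy are no
minimizers and need not be compared with). -/
def IsMinimizer (W : Torus d L → ℝ) (θ : ℝ) (ρ : Torus d L → ℝ) : Prop :=
  IsAdmissible W ρ ∧ ∀ σ, IsAdmissible W σ → freeEnergy W θ ρ ≤ freeEnergy W θ σ

/-- `ρ` is a minimizer of `ℱ_θ` that is not (a.e. equal to) the uniform density. -/
def IsNontrivialMinimizer (W : Torus d L → ℝ) (θ : ℝ) (ρ : Torus d L → ℝ) : Prop :=
  IsMinimizer W θ ρ ∧ ¬ ρ =ᵐ[volume] uniformDensity d L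

/-- The uniform density is the unique minimizer of `ℱ_θ`. -/
def UniformIsUniqueMinimizer (W : Torus d L → ℝ) (θ : ℝ) : Prop :=
  IsMinimizer W θ (uniformDensity d L) ∧
    ∀ ρ, IsMinimizer W θ ρ → ρ =ᵐ[volume] uniformDensity d L

/-- `F_θ = inf ℱ_θ`. -/
def minFreeEnergy (W : Torus d L → ℝ) (θ : ℝ) : ℝ :=
  sInf {r | ∃ ρ, IsAdmissible W ρ ∧ r = freeEnergy W θ ρ}

/-- `S_θ`, the infimum of `𝒮` over the minimizers of `ℱ_θ`. -/
def equilibriumEntropy (W : Torus d L → ℝ) (θ : ℝ) : ℝ :=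
  sInf {r | ∃ ρ, IsMinimizer W θ ρ ∧ r = entropy ρ}

/-- `E_θ`, the infimum of `(θ / 2) L ^ d ℰ(ρ, ρ)` over the minimizers of `ℱ_θ`. -/
def equilibriumEnergy (W : Torus d L → ℝ) (θ : ℝ) : ℝ :=
  sInf {r | ∃ ρ, IsMinimizer W θ ρ ∧ r = 1 / 2 * θ * L ^ d * energy W ρ ρ}

/-- A family `ρ_θ`, `θ > θ₀`, of nontrivial minimizers. -/
def IsNontrivialFamily (W : Torus d L → ℝ) (θ₀ : ℝ) (ρ : ℝ → Torus d L → ℝ) : Prop :=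
  ∀ θ, θ₀ < θ → IsNontrivialMinimizer W θ (ρ θ)

/-- `‖ρ₀ - ρ_θ‖₁ → 0` as `θ ↓ θ₀`. -/
def MergesWithUniform (θ₀ : ℝ) (ρ : ℝ → Torus d L → ℝ) : Prop :=
  Tendsto (fun θ => ∫ x, |uniformDensity d L x - ρ θ x|) (𝓝[>] θ₀) (𝓝 0)

/-- A lower transition point: the value of `θ` at which the phase in which `ρ₀` is the unique
minimizer, which begins at `θ = 0`, ends. -/
structure IsLowerTransition (W : Torus d L → ℝ) (θ₀ : ℝ) : Prop where
  pos : 0 < θ₀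
  below : ∀ θ, 0 ≤ θ → θ < θ₀ → UniformIsUniqueMinimizer W θ
  above : ∀ θ, θ₀ < θ → ∃ ρ, IsNontrivialMinimizer W θ ρ

/-- A (lower) critical point, that is, a continuous transition. -/
structure IsLowerCritical (W : Torus d L → ℝ) (θc : ℝ) : Prop where
  nonneg : 0 ≤ θc
  below : ∀ θ, 0 ≤ θ → θ ≤ θc → UniformIsUniqueMinimizer W θ
  above : ∀ θ, θc < θ → ∃ ρ, IsNontrivialMinimizer W θ ρ
  continuous : ∀ ρ, IsNontrivialFamily W θc ρ → MergesWithUniform θc ρ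

/-- A discontinuous transition: a lower transition that is not critical. -/
def IsDiscontinuousTransition (W : Torus d L → ℝ) (θT : ℝ) : Prop :=
  IsLowerTransition W θT ∧ ¬ IsLowerCritical W θT

end

end

end McKeanVlasov

open McKeanVlasov

/-! For $L>2a$ the torus coefficients are samples at $n/L$ of one continuous function, the Fourier
transform of $V$ on $\mathbb R^d$ (`fourierCoefficient_torusPotential`). It vanishes at infinity, so
a negative value yields a minimum $w<0$, independent of $L$; by isotropy it is attained on a whole
sphere. In dimension at least two that sphere carries triples of wave vectors with sum zero, and for
large $L$ the lattice has triples arbitrarily close to them (`exists_resonant_triads`).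

With $\eta=L^d\rho-1$ and $g(t)=(1+t)\log(1+t)-t=t^2/2-t^3/6+O(t^4)$, the excess free energy times
$L^d$ is exactly $\int g(\eta)+\frac\theta2\mathcal E(\eta,\eta)$ (`IsDensity.freeEnergy_sub`). At
$\theta=1/|w|$ the quadratic part nearly vanishes on a resonant triad of cosines, while
$\int\eta^3>0$. The cubic term therefore makes the uniform density lose already at $1/|w|$
(`exists_trial_density`), and $1/|w|\le\theta^\sharp$ because $w$ is below every coefficient.

The couplings at which $\rho_0$ minimizes form a closed interval $[0,\theta_T]$, so
$0<\theta_T<1/|w|$. Up to any $\Theta<1/|w|$, $\rho_0$ is a strict $L^1$-local minimizer among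
densities with a common bound (`IsCoercive.exists_local_stability`), and minimizers do have a common
bound (`exists_uniform_bound`). Hence nontrivial minimizers keep a definite distance from $\rho_0$,
in $L^1$ and in entropy (`IsCoercive.exists_separation`). The entropy gap forces an energy gap.
Energy is weakly continuous and entropy weakly lower semicontinuous, so a weak limit as
$\theta\downarrow\theta_T$ is a nontrivial minimizer at $\theta_T$
(`IsCoercive.exists_nontrivialMinimizer_of_isLUB`). Coexistence, the jumps and the absence of
critical points follow. -/

namespace McKeanVlasov

/-! ### The interaction energy of bounded functions on the torus -/

section Energy

variable {d : ℕ} {L : ℝ} [Fact (0 < L)]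

theorem volume_torus : (volume : Measure (Torus d L)) Set.univ = ENNReal.ofReal (L ^ d) := by
  have hL : 0 < L := Fact.out
  rw [volume_pi, Measure.pi_univ]
  simp [AddCircle.measure_univ, ENNReal.ofReal_pow hL.le]

theorem volume_real_torus : (volume : Measure (Torus d L)).real Set.univ = L ^ d := by
  have hL : 0 < L := Fact.out
  rw [Measure.real, volume_torus, ENNReal.toReal_ofReal (by positivity)]

theorem side_pow_pos (d : ℕ) (L : ℝ) [Fact (0 < L)] : 0 < L ^ d :=
  pow_pos Fact.out d

theorem integral_const_torus (c : ℝ) : ∫ _ : Torus d L, c = L ^ d * c := by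
  rw [integral_const, volume_real_torus, smul_eq_mul]

instance isNegInvariant_volume_torus : (volume : Measure (Torus d L)).IsNegInvariant :=
  Measure.IsAddHaarMeasure.isNegInvariant_of_regular _

/-- `f` is measurable and bounded by `C` almost everywhere. -/
structure IsBoundedBy (f : Torus d L → ℝ) (C : ℝ) : Prop where
  meas : AEStronglyMeasurable f volume
  bound : ∀ᵐ x, |f x| ≤ C

namespace IsBoundedBy

variable {f g : Torus d L → ℝ} {C D : ℝ}

theorem nonneg (hf : IsBoundedBy f C) : 0 ≤ C := by
  have : NeZero (volume : Measure (Torus d L)) := ⟨fun h => by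
    have h1 := volume_torus (d := d) (L := L)
    rw [h] at h1
    have := side_pow_pos d L
    simp at h1
    linarith⟩
  obtain ⟨x, hx⟩ := hf.bound.exists
  exact (abs_nonneg _).trans hx

theorem integrable (hf : IsBoundedBy f C) : Integrable f volume :=
  Integrable.of_bound hf.meas C (by simpa using hf.bound)

theorem mono (hf : IsBoundedBy f C) (h : C ≤ D) : IsBoundedBy f D :=
  ⟨hf.meas, hf.bound.mono fun _ hx => hx.trans h⟩

theorem add (hf : IsBoundedBy f C) (hg : IsBoundedBy g D) :
    IsBoundedBy (fun x => f x + g x) (C + D) :=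
  ⟨hf.meas.add hg.meas, by
    filter_upwards [hf.bound, hg.bound] with x h1 h2
    exact (abs_add_le _ _).trans (add_le_add h1 h2)⟩

theorem sub (hf : IsBoundedBy f C) (hg : IsBoundedBy g D) :
    IsBoundedBy (fun x => f x - g x) (C + D) :=
  ⟨hf.meas.sub hg.meas, by
    filter_upwards [hf.bound, hg.bound] with x h1 h2
    exact (abs_sub _ _).trans (add_le_add h1 h2)⟩

theorem mul (hf : IsBoundedBy f C) (hg : IsBoundedBy g D) :
    IsBoundedBy (fun x => f x * g x) (C * D) :=
  ⟨hf.meas.mul hg.meas, by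
    filter_upwards [hf.bound, hg.bound] with x h1 h2
    rw [abs_mul]
    exact mul_le_mul h1 h2 (abs_nonneg _) ((abs_nonneg _).trans h1)⟩

theorem const_mul (hf : IsBoundedBy f C) (c : ℝ) : IsBoundedBy (fun x => c * f x) (|c| * C) :=
  ⟨hf.meas.const_mul c, hf.bound.mono fun x hx => by
    rw [abs_mul]; exact mul_le_mul_of_nonneg_left hx (abs_nonneg _)⟩

theorem abs (hf : IsBoundedBy f C) : IsBoundedBy (fun x => |f x|) C :=
  ⟨hf.meas.norm, by simpa using hf.bound⟩

theorem const (c : ℝ) : IsBoundedBy (fun _ : Torus d L => c) |c| :=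
  ⟨aestronglyMeasurable_const, by simp⟩

theorem integrable_sq (hf : IsBoundedBy f C) : Integrable (fun x => f x ^ 2) volume := by
  simpa only [sq] using (hf.mul hf).integrable

end IsBoundedBy

theorem ae_fst {P : Torus d L → Prop} (h : ∀ᵐ x, P x) :
    ∀ᵐ p : Torus d L × Torus d L, P p.1 :=
  Measure.quasiMeasurePreserving_fst.ae h

theorem ae_snd {P : Torus d L → Prop} (h : ∀ᵐ x, P x) :
    ∀ᵐ p : Torus d L × Torus d L, P p.2 :=
  Measure.quasiMeasurePreserving_snd.ae h

theorem ae_sub {P : Torus d L → Prop} (h : ∀ᵐ x, P x) :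
    ∀ᵐ p : Torus d L × Torus d L, P (p.1 - p.2) :=
  (quasiMeasurePreserving_sub_of_right_invariant volume volume).ae h

variable {W : Torus d L → ℝ} {f g u v : Torus d L → ℝ} {C D : ℝ}

theorem integrable_kernel_snd (hW : Integrable W) (hf : Integrable f) :
    Integrable (fun p : Torus d L × Torus d L => W (p.1 - p.2) * f p.2) := by
  have := hf.convolution_integrand (ContinuousLinearMap.mul ℝ ℝ) hW
  rw [Measure.volume_eq_prod]
  simpa [mul_comm] using this

theorem integrable_kernel_fst (hW : Integrable W) (hs : ∀ x, W (-x) = W x) (hf : Integrable f) :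
    Integrable (fun p : Torus d L × Torus d L => W (p.1 - p.2) * f p.1) := by
  have := (integrable_kernel_snd hW hf).swap
  refine this.congr (ae_of_all _ fun p => ?_)
  simp only [Function.comp, Prod.fst_swap, Prod.snd_swap]
  rw [← hs, neg_sub]

theorem integral_kernel_snd (hW : Integrable W) (hf : Integrable f) :
    ∫ p : Torus d L × Torus d L, W (p.1 - p.2) * f p.2 = (∫ x, W x) * ∫ x, f x := by
  rw [Measure.volume_eq_prod, integral_prod_symm _ (integrable_kernel_snd hW hf)]
  simp_rw [integral_mul_const, integral_sub_right_eq_self (fun x => W x), integral_const_mul]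

theorem integral_kernel_fst (hW : Integrable W) (hs : ∀ x, W (-x) = W x) (hf : Integrable f) :
    ∫ p : Torus d L × Torus d L, W (p.1 - p.2) * f p.1 = (∫ x, W x) * ∫ x, f x := by
  rw [← integral_kernel_snd hW hf, Measure.volume_eq_prod,
    ← integral_prod_swap]
  refine integral_congr_ae (ae_of_all _ fun p => ?_)
  simp only [Prod.fst_swap, Prod.snd_swap]
  rw [← hs, neg_sub]

/-- The kernel is only integrable, possibly unbounded above, so one factor has to be bounded; the
other enters through the convolution integrand. -/
theorem integrable_kernel_bdd_snd (hW : Integrable W)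
    (hf : IsBoundedBy f C) (hg : Integrable g) :
    Integrable (fun p : Torus d L × Torus d L => W (p.1 - p.2) * f p.1 * g p.2) := by
  refine ((integrable_kernel_snd hW hg).mul_bdd (c := C) (g := fun p => f p.1) (hf.meas.comp_fst) (by
    simpa using ae_fst hf.bound)).congr (ae_of_all _ fun p => ?_)
  ring_nf

theorem integrable_kernel (hW : Integrable W) (hf : IsBoundedBy f C) (hg : IsBoundedBy g D) :
    Integrable (fun p : Torus d L × Torus d L => W (p.1 - p.2) * f p.1 * g p.2) :=
  integrable_kernel_bdd_snd hW hf hg.integrable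

theorem energy_congr {f' g' : Torus d L → ℝ} (hf : f =ᵐ[volume] f') (hg : g =ᵐ[volume] g') :
    energy W f g = energy W f' g' := by
  refine integral_congr_ae ?_
  filter_upwards [ae_fst hf, ae_snd hg] with p h1 h2
  rw [h1, h2]

theorem energy_comm (hs : ∀ x, W (-x) = W x) : energy W f g = energy W g f := by
  unfold energy
  rw [Measure.volume_eq_prod, ← integral_prod_swap]
  refine integral_congr_ae (ae_of_all _ fun p => ?_)
  simp only [Prod.fst_swap, Prod.snd_swap]
  rw [← hs, neg_sub]
  ring

theorem energy_const_mul (c c' : ℝ) :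
    energy W (fun x => c * f x) (fun x => c' * g x) = c * c' * energy W f g := by
  unfold energy
  rw [← integral_const_mul]
  congr 1
  ext p
  ring

theorem energy_one_right (hW : Integrable W) (hs : ∀ x, W (-x) = W x) (hf : Integrable f) :
    energy W f (fun _ => 1) = (∫ x, W x) * ∫ x, f x := by
  simp only [energy, mul_one]
  exact integral_kernel_fst hW hs hf

theorem energy_add_left (hW : Integrable W) {C' : ℝ} (hf : IsBoundedBy f C) (hu : IsBoundedBy u C')
    (hg : IsBoundedBy g D) :
    energy W (fun x => f x + u x) g = energy W f g + energy W u g := by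
  unfold energy
  rw [← integral_add (integrable_kernel hW hf hg) (integrable_kernel hW hu hg)]
  congr 1
  ext p
  ring

theorem energy_add_right (hW : Integrable W) {C' : ℝ} (hf : IsBoundedBy f C)
    (hu : IsBoundedBy u C') (hg : IsBoundedBy g D) :
    energy W g (fun x => f x + u x) = energy W g f + energy W g u := by
  unfold energy
  rw [← integral_add (integrable_kernel hW hg hf) (integrable_kernel hW hg hu)]
  congr 1
  ext p
  ring

theorem energy_add_self (hW : Integrable W) (hs : ∀ x, W (-x) = W x) (hf : IsBoundedBy f C)
    (hg : IsBoundedBy g D) :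
    energy W (fun x => f x + g x) (fun x => f x + g x)
      = energy W f f + 2 * energy W f g + energy W g g := by
  rw [energy_add_left hW hf hg (hf.add hg), energy_add_right hW hf hg hf,
    energy_add_right hW hf hg hg, energy_comm hs (f := g) (g := f)]
  ring

/-- Energies of functions bounded by `C` are Lipschitz in `L¹`. -/
theorem abs_energy_sub_le (hW : Integrable W) (hs : ∀ x, W (-x) = W x)
    (hf : IsBoundedBy f C) (hg : IsBoundedBy g C) :
    |energy W f f - energy W g g| ≤ 2 * C * (∫ x, |W x|) * ∫ x, |f x - g x| := by
  have hC := hf.nonneg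
  have hd := (hf.sub hg).abs
  have hs' : ∀ x, |W (-x)| = |W x| := fun x => by rw [hs]
  have h1 := integrable_kernel_fst hW.abs hs' hd.integrable
  have h2 := integrable_kernel_snd hW.abs hd.integrable
  have key : |energy W f f - energy W g g| ≤
      ∫ p : Torus d L × Torus d L, (C * (|W (p.1 - p.2)| * |f p.1 - g p.1|) +
        C * (|W (p.1 - p.2)| * |f p.2 - g p.2|)) := by
    unfold energy
    rw [← integral_sub (integrable_kernel hW hf hf) (integrable_kernel hW hg hg),
      ← Real.norm_eq_abs]
    refine norm_integral_le_of_norm_le ((h1.const_mul C).add (h2.const_mul C)) ?_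
    filter_upwards [ae_fst hg.bound, ae_snd hf.bound] with p hp1 hp2
    have e : W (p.1 - p.2) * f p.1 * f p.2 - W (p.1 - p.2) * g p.1 * g p.2 =
      W (p.1 - p.2) * ((f p.1 - g p.1) * f p.2 + g p.1 * (f p.2 - g p.2)) := by ring
    rw [e, Real.norm_eq_abs, abs_mul]
    have : |(f p.1 - g p.1) * f p.2 + g p.1 * (f p.2 - g p.2)| ≤
        |f p.1 - g p.1| * C + C * |f p.2 - g p.2| := by
      refine (abs_add_le _ _).trans ?_
      rw [abs_mul, abs_mul]
      gcongr
    calc _ ≤ |W (p.1 - p.2)| * (|f p.1 - g p.1| * C + C * |f p.2 - g p.2|) := by gcongr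
      _ = _ := by ring
  rw [integral_add (h1.const_mul C) (h2.const_mul C), integral_const_mul, integral_const_mul,
    integral_kernel_fst hW.abs hs' hd.integrable, integral_kernel_snd hW.abs hd.integrable] at key
  linarith

theorem abs_integral_sq_sub_le (hf : IsBoundedBy f C) (hg : IsBoundedBy g C) :
    |(∫ x, f x ^ 2) - ∫ x, g x ^ 2| ≤ 2 * C * ∫ x, |f x - g x| := by
  rw [← integral_sub hf.integrable_sq hg.integrable_sq, ← integral_const_mul, ← Real.norm_eq_abs]
  refine norm_integral_le_of_norm_le ((hf.sub hg).abs.integrable.const_mul _) ?_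
  filter_upwards [hf.bound, hg.bound] with x h1 h2
  rw [show f x ^ 2 - g x ^ 2 = (f x + g x) * (f x - g x) by ring, norm_mul, Real.norm_eq_abs,
    Real.norm_eq_abs]
  gcongr
  exact (abs_add_le _ _).trans (by linarith)

/-- The energy of a bounded function is controlled by its `L²` norm. -/
theorem abs_energy_le (hW : Integrable W) (hs : ∀ x, W (-x) = W x) (hf : IsBoundedBy f C) :
    |energy W f f| ≤ (∫ x, |W x|) * ∫ x, f x ^ 2 := by
  have hs' : ∀ x, |W (-x)| = |W x| := fun x => by rw [hs]
  have h1 := integrable_kernel_fst hW.abs hs' hf.integrable_sq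
  have h2 := integrable_kernel_snd hW.abs hf.integrable_sq
  have key : |energy W f f| ≤
      ∫ p : Torus d L × Torus d L, (1 / 2 * (|W (p.1 - p.2)| * f p.1 ^ 2) +
        1 / 2 * (|W (p.1 - p.2)| * f p.2 ^ 2)) := by
    unfold energy
    rw [← Real.norm_eq_abs]
    refine norm_integral_le_of_norm_le ((h1.const_mul _).add (h2.const_mul _))
      (ae_of_all _ fun p => ?_)
    rw [mul_assoc, norm_mul, Real.norm_eq_abs, Real.norm_eq_abs]
    have : |f p.1 * f p.2| ≤ 1 / 2 * (f p.1 ^ 2 + f p.2 ^ 2) := by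
      rw [abs_le]
      constructor <;> nlinarith [sq_nonneg (f p.1 - f p.2), sq_nonneg (f p.1 + f p.2)]
    calc _ ≤ |W (p.1 - p.2)| * (1 / 2 * (f p.1 ^ 2 + f p.2 ^ 2)) := by gcongr
      _ = _ := by ring
  rw [integral_add (h1.const_mul _) (h2.const_mul _), integral_const_mul, integral_const_mul,
    integral_kernel_fst hW.abs hs' hf.integrable_sq,
    integral_kernel_snd hW.abs hf.integrable_sq] at key
  linarith

/-- The energy of two bounded functions, with the kernel cut off at height `B`. -/
theorem abs_energy_le_cutoff (hW : Integrable W) (hs : ∀ x, W (-x) = W x)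
    (hf : IsBoundedBy f C) (hg : IsBoundedBy g D) (B : ℝ) :
    |energy W f g| ≤
      (B * (∫ x, |g x|) + D * ∫ x, max (|W x| - B) 0) * ∫ x, |f x| := by
  have hD := hg.nonneg
  have hWB : Integrable (fun x => max (|W x| - B) 0) :=
    (hW.abs.sub (integrable_const B)).sup (integrable_const 0)
  have hs' : ∀ x, max (|W (-x)| - B) 0 = max (|W x| - B) 0 := fun x => by rw [hs]
  have h1 := integrable_kernel_fst hWB hs' hf.abs.integrable
  have h2 : Integrable (fun p : Torus d L × Torus d L => |f p.1| * |g p.2|) :=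
    hf.abs.integrable.mul_prod hg.abs.integrable
  have key : |energy W f g| ≤ ∫ p : Torus d L × Torus d L,
      (B * (|f p.1| * |g p.2|) + D * (max (|W (p.1 - p.2)| - B) 0 * |f p.1|)) := by
    unfold energy
    rw [← Real.norm_eq_abs]
    refine norm_integral_le_of_norm_le ((h2.const_mul _).add (h1.const_mul _)) ?_
    filter_upwards [ae_snd hg.bound] with p hp
    rw [norm_mul, norm_mul, Real.norm_eq_abs, Real.norm_eq_abs, Real.norm_eq_abs]
    -- The part of the kernel below height `B` is paired with the $L^1$ norm of `g`, the part above
    -- it with the sup bound of `g`.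
    have h3 : |W (p.1 - p.2)| ≤ B + max (|W (p.1 - p.2)| - B) 0 := by
      linarith [le_max_left (|W (p.1 - p.2)| - B) 0]
    have h4 : 0 ≤ max (|W (p.1 - p.2)| - B) 0 := le_max_right _ _
    calc _ ≤ (B + max (|W (p.1 - p.2)| - B) 0) * |f p.1| * |g p.2| := by gcongr
      _ = B * (|f p.1| * |g p.2|) + |g p.2| * (max (|W (p.1 - p.2)| - B) 0 * |f p.1|) := by ring
      _ ≤ _ := by gcongr
  rw [integral_add (h2.const_mul _) (h1.const_mul _), integral_const_mul, integral_const_mul,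
    integral_kernel_fst hWB hs' hf.abs.integrable, Measure.volume_eq_prod,
    integral_prod_mul (fun x => |f x|) (fun x => |g x|)] at key
  linarith

/-- Dominated convergence. The small tail is what replaces boundedness of the potential in the
stability estimate. -/
theorem tendsto_integral_cutoff (hW : Integrable W) :
    Tendsto (fun n : ℕ => ∫ x, max (|W x| - n) (0 : ℝ)) atTop (𝓝 0) := by
  suffices h : Tendsto (fun n : ℕ => ∫ x, max (|W x| - n) (0 : ℝ)) atTop
      (𝓝 (∫ _ : Torus d L, (0 : ℝ))) by simpa using h
  refine tendsto_integral_of_dominated_convergence (f := fun _ => 0) (fun x => |W x|) ?_ hW.abs ?_ ?_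
  · intro n
    exact ((hW.abs.sub (integrable_const _)).sup (integrable_const 0)).aestronglyMeasurable
  · intro n
    refine ae_of_all _ fun x => ?_
    rw [Real.norm_eq_abs, abs_of_nonneg (le_max_right _ _)]
    exact max_le (by linarith [(Nat.cast_nonneg n : (0 : ℝ) ≤ n)]) (abs_nonneg _)
  · refine ae_of_all _ fun x => ?_
    refine tendsto_const_nhds.congr' ?_
    filter_upwards [eventually_ge_atTop ⌈|W x|⌉₊] with n hn
    rw [max_eq_right]
    linarith [Nat.ceil_le.1 hn]

end Energy

end McKeanVlasov

/-! ### Relative entropy, and truncation of densities -/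

namespace McKeanVlasov

theorem integrable_fun_sub {α : Type*} [MeasurableSpace α] {μ : Measure α} {f g : α → ℝ}
    (hf : Integrable f μ) (hg : Integrable g μ) : Integrable (fun x => f x - g x) μ :=
  hf.sub hg

/-- `(1 + t) log (1 + t) - t`, the entropy density relative to the uniform state. -/
noncomputable def entropyGap (t : ℝ) : ℝ := (1 + t) * Real.log (1 + t) - t

/-- With $r=\sqrt{1+t}$ the right side is $2r^2\log r-r^2+1$, and $\log r\ge 1-1/r$ leaves
$(r-1)^2$. -/
theorem sqrt_sub_one_sq_le_entropyGap {t : ℝ} (ht : -1 ≤ t) :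
    (√(1 + t) - 1) ^ 2 ≤ entropyGap t := by
  unfold entropyGap
  rcases ht.eq_or_lt with rfl | ht
  · norm_num
  have h0 : 0 < 1 + t := by linarith
  set r := √(1 + t) with hr
  have hr0 : 0 < r := Real.sqrt_pos.2 h0
  have hrr : r ^ 2 = 1 + t := Real.sq_sqrt h0.le
  have hlog : Real.log (1 + t) = 2 * Real.log r := by
    rw [← hrr, Real.log_pow]; norm_num
  have h1 : 1 - r⁻¹ ≤ Real.log r := Real.one_sub_inv_le_log_of_pos hr0
  have h2 : r ^ 2 * (1 - r⁻¹) ≤ r ^ 2 * Real.log r := by gcongr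
  have h3 : r ^ 2 * (1 - r⁻¹) = r ^ 2 - r := by field_simp
  have ht' : t = r ^ 2 - 1 := by linarith
  rw [hlog, ← hrr, ht']
  nlinarith

theorem entropyGap_nonneg {t : ℝ} (ht : -1 ≤ t) : 0 ≤ entropyGap t :=
  (sq_nonneg _).trans (sqrt_sub_one_sq_le_entropyGap ht)

theorem entropyGap_pos {t : ℝ} (ht : -1 ≤ t) (h0 : t ≠ 0) : 0 < entropyGap t := by
  refine lt_of_lt_of_le ?_ (sqrt_sub_one_sq_le_entropyGap ht)
  have : √(1 + t) - 1 ≠ 0 := fun h => h0 <| by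
    have h1 := Real.sq_sqrt (show 0 ≤ 1 + t by linarith)
    rw [sub_eq_zero.1 h] at h1
    linarith
  positivity

/-- Factor $t^2=(r-1)^2(r+1)^2$ with $r=\sqrt{1+t}$, and use $(r+1)^2\le 2(r^2+1)=4+2t$. -/
theorem le_entropyGap {t T : ℝ} (ht : -1 ≤ t) (hT : t ≤ T) :
    t ^ 2 / (4 + 2 * T) ≤ entropyGap t := by
  refine le_trans ?_ (sqrt_sub_one_sq_le_entropyGap ht)
  have h0 : 0 ≤ 1 + t := by linarith
  set r := √(1 + t) with hr
  have hr0 : 0 ≤ r := Real.sqrt_nonneg _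
  have hrr : r ^ 2 = 1 + t := Real.sq_sqrt h0
  rw [div_le_iff₀ (by linarith)]
  have ht' : t = r ^ 2 - 1 := by linarith
  calc t ^ 2 = (r - 1) ^ 2 * (r + 1) ^ 2 := by rw [ht']; ring
    _ ≤ (r - 1) ^ 2 * (4 + 2 * T) := by
        gcongr
        nlinarith [sq_nonneg (r - 1)]

/-- Taylor expansion of the logarithm to third order. The negative cubic term is the source of the
discontinuity; the quartic constant is crude. -/
theorem abs_entropyGap_sub_le {t : ℝ} (ht : |t| ≤ 1 / 2) :
    |entropyGap t - (t ^ 2 / 2 - t ^ 3 / 6)| ≤ 4 * t ^ 4 := by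
  have h := Real.abs_log_sub_add_sum_range_le (x := -t) (by rw [abs_neg]; linarith) 3
  simp only [Finset.sum_range_succ, Finset.sum_range_zero, sub_neg_eq_add, abs_neg] at h
  norm_num at h
  have h4 : |t| ^ 4 = t ^ 4 := by rw [← abs_pow, abs_of_nonneg (by positivity)]
  have h5 : |t| ^ 4 / (1 - |t|) ≤ 2 * t ^ 4 := by
    rw [div_le_iff₀ (by linarith), h4]
    nlinarith [pow_nonneg (abs_nonneg t) 4, (by positivity : 0 ≤ t ^ 4)]
  obtain ⟨h1, h2⟩ := abs_le.1 (h.trans h5)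
  obtain ⟨h3, h6⟩ := abs_le.1 ht
  have e : (-t) ^ 3 = - t ^ 3 := by ring
  rw [e] at h1 h2
  unfold entropyGap
  have ht4 : 0 ≤ t ^ 4 := by positivity
  set l := Real.log (1 + t)
  have k1 : 0 ≤ (1 + t) * (2 * t ^ 4 - (-t + t ^ 2 / 2 + -t ^ 3 / 3 + l)) :=
    mul_nonneg (by linarith) (by linarith)
  have k2 : 0 ≤ (1 + t) * ((-t + t ^ 2 / 2 + -t ^ 3 / 3 + l) + 2 * t ^ 4) :=
    mul_nonneg (by linarith) (by linarith)
  have k3 : t * t ^ 4 ≤ 1 / 2 * t ^ 4 := by gcongr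
  have k4 : - (1 / 2) * t ^ 4 ≤ t * t ^ 4 := by gcongr
  rw [abs_le]
  constructor <;> nlinarith

/-- Convexity of $x\log x$: its graph lies above the tangent at `y`. All comparisons of the
entropies of two densities below go through this pointwise bound. -/
theorem tangent_le_mul_log {x y : ℝ} (hx : 0 ≤ x) (hy : 0 < y) :
    (Real.log y + 1) * (x - y) ≤ x * Real.log x - y * Real.log y := by
  rcases hx.eq_or_lt with rfl | hx
  · simp; linarith
  have h := Real.log_le_sub_one_of_pos (div_pos hy hx)
  rw [Real.log_div hy.ne' hx.ne'] at h
  have h2 : x * (Real.log y - Real.log x) ≤ x * (y / x - 1) := by gcongr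
  have h3 : x * (y / x - 1) = y - x := by field_simp
  nlinarith

section Density

variable {d : ℕ} {L : ℝ} [Fact (0 < L)] {W ρ : Torus d L → ℝ} {C : ℝ}

theorem continuous_mul_log : Continuous fun x : ℝ => x * Real.log x :=
  Real.continuous_mul_log

theorem IsBoundedBy.mul_log (hf : IsBoundedBy ρ C) :
    ∃ D, IsBoundedBy (fun x => ρ x * Real.log (ρ x)) D := by
  obtain ⟨D, hD⟩ := (isCompact_Icc (a := -C) (b := C)).exists_bound_of_continuousOn
    continuous_mul_log.continuousOn
  refine ⟨D, continuous_mul_log.comp_aestronglyMeasurable hf.meas, ?_⟩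
  filter_upwards [hf.bound] with x hx
  exact hD _ (abs_le.1 hx)

theorem IsDensity.isAdmissible (h : IsDensity ρ) (hb : IsBoundedBy ρ C) (hW : Integrable W) :
    IsAdmissible W ρ := by
  obtain ⟨D, hD⟩ := hb.mul_log
  exact ⟨h, hD.integrable, integrable_kernel hW hb hb⟩

theorem isDensity_uniform : IsDensity (uniformDensity d L) := by
  have := side_pow_pos d L
  refine ⟨integrable_const _, ae_of_all _ fun _ => (inv_pos.2 this).le, ?_⟩
  simp only [uniformDensity, integral_const_torus]
  field_simp

theorem isBoundedBy_uniform : IsBoundedBy (uniformDensity d L) (L ^ d)⁻¹ := by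
  have := side_pow_pos d L
  have h := IsBoundedBy.const (d := d) (L := L) (L ^ d)⁻¹
  rwa [abs_of_pos (inv_pos.2 this)] at h

theorem isAdmissible_uniform (hW : Integrable W) : IsAdmissible W (uniformDensity d L) :=
  isDensity_uniform.isAdmissible isBoundedBy_uniform hW

theorem entropy_uniform : entropy (uniformDensity d L) = - Real.log (L ^ d) := by
  have := side_pow_pos d L
  simp only [entropy, uniformDensity, integral_const_torus, Real.log_inv]
  field_simp

theorem energy_uniform (hW : Integrable W) :
    energy W (uniformDensity d L) (uniformDensity d L) = (L ^ d)⁻¹ * ∫ x, W x := by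
  have hN := side_pow_pos d L
  have h := integral_kernel_snd hW (integrable_const (μ := volume) (1 : ℝ))
  simp only [energy, uniformDensity]
  simp only [mul_one, integral_const_torus] at h
  rw [integral_mul_const, integral_mul_const, h]
  field_simp

theorem IsDensity.gap_eq (h : IsDensity ρ) :
    ∀ᵐ x, entropyGap (L ^ d * ρ x - 1) =
      L ^ d * (ρ x * Real.log (ρ x)) + L ^ d * (Real.log (L ^ d) - 1) * ρ x + 1 := by
  have hN := side_pow_pos d L
  filter_upwards [h.nonneg] with x hx
  unfold entropyGap
  rw [show 1 + (L ^ d * ρ x - 1) = L ^ d * ρ x by ring]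
  rcases (show 0 ≤ ρ x from hx).eq_or_lt with h0 | h0
  · rw [← h0]; simp
  · rw [Real.log_mul hN.ne' h0.ne']; ring

theorem IsDensity.integrable_gap (h : IsDensity ρ)
    (he : Integrable (fun x => ρ x * Real.log (ρ x))) :
    Integrable fun x => entropyGap (L ^ d * ρ x - 1) :=
  (((he.const_mul _).add (h.integrable.const_mul _)).add (integrable_const 1)).congr
    (h.gap_eq.mono fun _ hx => hx.symm)

/-- Mass one turns the linear and constant terms of the pointwise identity into the entropy of the
uniform state. -/
theorem IsDensity.integral_gap (h : IsDensity ρ)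
    (he : Integrable (fun x => ρ x * Real.log (ρ x))) :
    ∫ x, entropyGap (L ^ d * ρ x - 1) =
      L ^ d * (entropy ρ - entropy (uniformDensity d L)) := by
  rw [integral_congr_ae h.gap_eq, integral_add ((he.const_mul _).fun_add (h.integrable.const_mul _))
    (integrable_const 1), integral_add (he.const_mul _) (h.integrable.const_mul _),
    integral_const_mul, integral_const_mul, h.integral_eq_one, integral_const_torus,
    entropy_uniform, entropy]
  ring

theorem IsDensity.neg_one_le (h : IsDensity ρ) : ∀ᵐ x, -1 ≤ L ^ d * ρ x - 1 := by
  have hN := side_pow_pos d L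
  filter_upwards [h.nonneg] with x hx
  have : 0 ≤ L ^ d * ρ x := mul_nonneg hN.le hx
  linarith

/-- Gibbs' inequality: the relative entropy density is nonnegative and vanishes only at fluctuation
zero. -/
theorem IsDensity.entropy_uniform_lt (h : IsDensity ρ)
    (he : Integrable (fun x => ρ x * Real.log (ρ x)))
    (hne : ¬ ρ =ᵐ[volume] uniformDensity d L) :
    entropy (uniformDensity d L) < entropy ρ := by
  have hN := side_pow_pos d L
  have h0 : 0 ≤ᵐ[volume] fun x => entropyGap (L ^ d * ρ x - 1) :=
    h.neg_one_le.mono fun x hx => entropyGap_nonneg hx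
  have h1 := integral_nonneg_of_ae h0
  rcases h1.eq_or_lt with h2 | h2
  · exfalso
    have h3 := (integral_eq_zero_iff_of_nonneg_ae h0 (h.integrable_gap he)).1 h2.symm
    refine hne ?_
    filter_upwards [h3, h.neg_one_le] with x hx hx1
    by_contra hcon
    refine (entropyGap_pos hx1 fun h4 => hcon ?_).ne' hx
    simp only [uniformDensity]
    refine eq_inv_of_mul_eq_one_right ?_
    linarith
  · rw [h.integral_gap he] at h2
    have := (mul_pos_iff_of_pos_left hN).1 h2
    linarith

theorem IsDensity.entropy_uniform_le (h : IsDensity ρ)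
    (he : Integrable (fun x => ρ x * Real.log (ρ x))) :
    entropy (uniformDensity d L) ≤ entropy ρ := by
  by_cases hne : ρ =ᵐ[volume] uniformDensity d L
  · refine (integral_congr_ae ?_).le
    filter_upwards [hne] with x hx
    rw [hx]
  · exact (h.entropy_uniform_lt he hne).le

/-- Cutting a density off at height `M` and spreading the excess mass uniformly. -/
theorem IsAdmissible.exists_truncation (hW : Integrable W) (hs : ∀ x, W (-x) = W x) {K : ℝ}
    (hK : ∀ᵐ x, -K ≤ W x) (hρ : IsAdmissible W ρ) {M : ℝ} (hM : 0 < M) {θ : ℝ} (hθ : 0 ≤ θ) :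
    ∃ σ : Torus d L → ℝ, IsDensity σ ∧ IsBoundedBy σ (M + (L ^ d)⁻¹) ∧
      (∫ x, max (ρ x - M) 0) *
        (Real.log M + Real.log (L ^ d) - θ * (L ^ d * K + ∫ x, |W x|)) ≤
          freeEnergy W θ ρ - freeEnergy W θ σ := by
  have hN := side_pow_pos d L
  set N := L ^ d with hNdef
  set g : Torus d L → ℝ := fun x => max (ρ x - M) 0 with hg
  set m := ∫ x, g x with hm
  have hρi := hρ.isDensity.integrable
  have hgi : Integrable g := (hρi.sub (integrable_const M)).sup (integrable_const 0)
  have hg0 : ∀ x, 0 ≤ g x := fun x => le_max_right _ _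
  have hm0 : 0 ≤ m := integral_nonneg hg0
  have hgρ : ∀ᵐ x, g x ≤ ρ x := by
    filter_upwards [hρ.isDensity.nonneg] with x hx
    exact max_le (by linarith) hx
  have hm1 : m ≤ 1 := by
    rw [hm, ← hρ.isDensity.integral_eq_one]
    exact integral_mono_ae hgi hρi hgρ
  -- Without excess mass the density is already below `M` and serves as its own truncation.
  rcases hm0.eq_or_lt with hm' | hmpos
  · have h1 := (integral_eq_zero_iff_of_nonneg hg0 hgi).1 hm'.symm
    refine ⟨ρ, hρ.isDensity, ⟨hρi.aestronglyMeasurable, ?_⟩, by rw [← hm']; simp⟩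
    filter_upwards [h1, hρ.isDensity.nonneg] with x hx hx0
    have h2 : ρ x - M ≤ g x := le_max_left _ _
    rw [hx] at h2
    rw [abs_of_nonneg hx0]
    have : 0 < N⁻¹ := inv_pos.2 hN
    simp only [Pi.zero_apply] at h2
    linarith
  set σ : Torus d L → ℝ := fun x => ρ x - g x + m / N with hσ
  have hσi : Integrable σ := (hρi.sub hgi).add (integrable_const _)
  have hmN : 0 < m / N := div_pos hmpos hN
  have hmN' : m / N ≤ N⁻¹ := by
    rw [div_eq_mul_inv]; exact mul_le_of_le_one_left (inv_pos.2 hN).le hm1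
  have hσ0 : ∀ᵐ x, m / N ≤ σ x := by
    filter_upwards [hgρ] with x hx
    simp only [hσ]; linarith
  have hσint : ∫ x, σ x = 1 := by
    simp only [hσ]
    rw [integral_add (integrable_fun_sub hρi hgi) (integrable_const _), integral_sub hρi hgi,
      hρ.isDensity.integral_eq_one, integral_const_torus, ← hm, ← hNdef]
    field_simp
    ring
  have hσd : IsDensity σ := ⟨hσi, hσ0.mono fun x hx => hmN.le.trans hx, hσint⟩
  have hσb : IsBoundedBy σ (M + N⁻¹) := by
    refine ⟨hσi.aestronglyMeasurable, ?_⟩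
    filter_upwards [hσ0] with x hx
    rw [abs_of_nonneg (hmN.le.trans hx)]
    have : ρ x - M ≤ g x := le_max_left _ _
    simp only [hσ]; linarith
  have hσa := hσd.isAdmissible hσb hW
  refine ⟨σ, hσd, hσb, ?_⟩
  -- Tangent inequality at `σ`. Where mass is removed, `σ` is at least `M`, which yields $\log M$
  -- per unit of mass; the cost of the spread mass is controlled by $\log(N\sigma)\le N\sigma-1$,
  -- whose right side integrates to zero.
  have hent : m * (Real.log M + Real.log N) ≤ entropy ρ - entropy σ := by
    have hi1 : Integrable fun x => (Real.log M + 1) * g x - m / N * (N * σ x - Real.log N) :=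
      (hgi.const_mul _).sub ((integrable_fun_sub (hσi.const_mul _) (integrable_const _)).const_mul _)
    have : ∫ x, ((Real.log M + 1) * g x - m / N * (N * σ x - Real.log N)) =
        m * (Real.log M + Real.log N) := by
      rw [integral_sub (hgi.const_mul _) ((integrable_fun_sub (hσi.const_mul _) (integrable_const _)).const_mul _),
        integral_const_mul, integral_const_mul,
        integral_sub (hσi.const_mul _) (integrable_const _), integral_const_mul,
        integral_const_torus, hσint, ← hm, ← hNdef]
      field_simp
      ring
    rw [← this, entropy, entropy, ← integral_sub hρ.entropy_finite hσa.entropy_finite]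
    refine integral_mono_ae hi1 (hρ.entropy_finite.sub hσa.entropy_finite) ?_
    filter_upwards [hσ0, hρ.isDensity.nonneg] with x hx hx0
    have hσp : 0 < σ x := hmN.trans_le hx
    refine le_trans ?_ (tangent_le_mul_log hx0 hσp)
    have e : ρ x - σ x = g x - m / N := by simp only [hσ]; ring
    rw [e, mul_sub (Real.log (σ x) + 1), mul_comm (Real.log (σ x) + 1) (m / N)]
    have h1 : (Real.log M + 1) * g x ≤ (Real.log (σ x) + 1) * g x := by
      rcases (hg0 x).eq_or_lt with h0 | h0
      · rw [← h0]; simp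
      · have : g x = ρ x - M := by
          simp only [hg] at h0 ⊢
          rcases max_cases (ρ x - M) 0 with h | h
          · exact h.1
          · rw [h.1] at h0; exact absurd h0 (lt_irrefl _)
        have h2 : M ≤ σ x := by simp only [hσ]; rw [this]; linarith
        have h3 := Real.log_le_log hM h2
        gcongr
    have h2 : Real.log (σ x) + 1 ≤ N * σ x - Real.log N := by
      have := Real.log_le_sub_one_of_pos (mul_pos hN hσp)
      rw [Real.log_mul hN.ne' hσp.ne'] at this
      linarith
    have h3 : m / N * (Real.log (σ x) + 1) ≤ m / N * (N * σ x - Real.log N) := by gcongr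
    linarith
  -- Removed mass interacts with energy at least `-K` per pair, the only information on the kernel
  -- usable against an unbounded `ρ`. Spread mass has constant density, so it costs only the $L^1$
  -- norm of the kernel.
  have hen : - (2 * m * (K + (∫ x, |W x|) / N)) ≤ energy W ρ ρ - energy W σ σ := by
    have hs' : ∀ x, |W (-x)| = |W x| := fun x => by rw [hs]
    have i1 : Integrable (fun p : Torus d L × Torus d L => g p.1 * ρ p.2) :=
      hgi.mul_prod hρi
    have i2 : Integrable (fun p : Torus d L × Torus d L => σ p.1 * g p.2) :=
      hσi.mul_prod hgi
    have i3 := integrable_kernel_snd hW.abs hρi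
    have i4 := integrable_kernel_fst hW.abs hs' hσi
    have i5 : Integrable fun p : Torus d L × Torus d L =>
      (-K * (g p.1 * ρ p.2) + -K * (σ p.1 * g p.2)) +
        (-(m / N) * (|W (p.1 - p.2)| * ρ p.2) + -(m / N) * (|W (p.1 - p.2)| * σ p.1)) :=
      ((i1.const_mul _).add (i2.const_mul _)).add ((i3.const_mul _).add (i4.const_mul _))
    have hval : ∫ p : Torus d L × Torus d L,
      ((-K * (g p.1 * ρ p.2) + -K * (σ p.1 * g p.2)) +
        (-(m / N) * (|W (p.1 - p.2)| * ρ p.2) + -(m / N) * (|W (p.1 - p.2)| * σ p.1))) =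
        - (2 * m * (K + (∫ x, |W x|) / N)) := by
      rw [integral_add ((i1.const_mul _).fun_add (i2.const_mul _))
          ((i3.const_mul _).fun_add (i4.const_mul _)),
        integral_add (i1.const_mul _) (i2.const_mul _),
        integral_add (i3.const_mul _) (i4.const_mul _), integral_const_mul, integral_const_mul,
        integral_const_mul, integral_const_mul, integral_kernel_snd hW.abs hρi,
        integral_kernel_fst hW.abs hs' hσi, Measure.volume_eq_prod, integral_prod_mul,
        integral_prod_mul, hσint, hρ.isDensity.integral_eq_one, ← hm]
      field_simp
      ring
    rw [← hval, energy, energy, ← integral_sub hρ.energy_finite hσa.energy_finite]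
    refine integral_mono_ae i5 (hρ.energy_finite.sub hσa.energy_finite) ?_
    filter_upwards [ae_sub hK, ae_snd hρ.isDensity.nonneg, ae_fst hσ0] with p h1 h2 h3
    have h3' : 0 ≤ σ p.1 := hmN.le.trans h3
    simp only [Pi.zero_apply] at h2
    set w := W (p.1 - p.2)
    have e : w * ρ p.1 * ρ p.2 - w * σ p.1 * σ p.2 =
        (w * (g p.1 * ρ p.2) + w * (σ p.1 * g p.2)) +
          (-(m / N) * (w * ρ p.2) + -(m / N) * (w * σ p.1)) := by
      have e1 : ρ p.1 = σ p.1 + g p.1 - m / N := by simp only [hσ]; ring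
      have e2 : σ p.2 = ρ p.2 - g p.2 + m / N := rfl
      rw [e2, e1]; ring
    rw [e]
    have l1 : -K * (g p.1 * ρ p.2) ≤ w * (g p.1 * ρ p.2) :=
      mul_le_mul_of_nonneg_right h1 (mul_nonneg (hg0 _) h2)
    have l2 : -K * (σ p.1 * g p.2) ≤ w * (σ p.1 * g p.2) :=
      mul_le_mul_of_nonneg_right h1 (mul_nonneg h3' (hg0 _))
    have l3 : m / N * (w * ρ p.2) ≤ m / N * (|w| * ρ p.2) := by
      gcongr; exact le_abs_self _
    have l4 : m / N * (w * σ p.1) ≤ m / N * (|w| * σ p.1) := by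
      gcongr; exact le_abs_self _
    linarith
  have : 1 / 2 * θ * N * (- (2 * m * (K + (∫ x, |W x|) / N))) ≤
      1 / 2 * θ * N * (energy W ρ ρ - energy W σ σ) := by gcongr
  have e : 1 / 2 * θ * N * (- (2 * m * (K + (∫ x, |W x|) / N))) =
      - (m * (θ * (N * K + ∫ x, |W x|))) := by field_simp
  unfold freeEnergy
  rw [← hNdef]
  linarith

/-- For bounded `θ`, minimizers are uniformly bounded, and it suffices to minimize over
uniformly bounded densities. -/
theorem exists_uniform_bound (hW : Integrable W) (hs : ∀ x, W (-x) = W x) {K : ℝ}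
    (hK : ∀ᵐ x, -K ≤ W x) (Θ : ℝ) :
    ∃ M : ℝ, ∀ θ, 0 ≤ θ → θ ≤ Θ →
      (∀ ρ, IsMinimizer W θ ρ → IsBoundedBy ρ M) ∧
      ∀ ρ, IsAdmissible W ρ → ∃ σ, IsDensity σ ∧ IsBoundedBy σ M ∧
        freeEnergy W θ σ ≤ freeEnergy W θ ρ := by
  have hN := side_pow_pos d L
  have hK' : ∀ᵐ x, -|K| ≤ W x := hK.mono fun x hx => (neg_le_neg (le_abs_self K)).trans hx
  set A := L ^ d * |K| + ∫ x, |W x| with hA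
  have hA0 : 0 ≤ A := add_nonneg (by positivity) (integral_nonneg fun _ => abs_nonneg _)
  -- This height makes the bracket in the truncation inequality at least 1 for all `θ ≤ Θ`, so
  -- truncation strictly gains unless the excess mass is zero.
  set M := Real.exp (1 + Θ * A - Real.log (L ^ d)) with hMdef
  have hM : 0 < M := Real.exp_pos _
  have hlog : ∀ θ, θ ≤ Θ → 1 ≤ Real.log M + Real.log (L ^ d) - θ * A := by
    intro θ hθ
    rw [hMdef, Real.log_exp]
    have : θ * A ≤ Θ * A := by gcongr
    linarith
  refine ⟨M + (L ^ d)⁻¹, fun θ h0 hθ => ⟨fun ρ hρ => ?_, fun ρ hρ => ?_⟩⟩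
  · obtain ⟨σ, hσ, hσb, h⟩ := hρ.1.exists_truncation hW hs hK' hM h0
    have h1 := hρ.2 σ (hσ.isAdmissible hσb hW)
    have hgi : Integrable (fun x => max (ρ x - M) 0) :=
      (hρ.1.isDensity.integrable.sub (integrable_const M)).sup (integrable_const 0)
    have hg0 : ∀ x, 0 ≤ max (ρ x - M) 0 := fun x => le_max_right _ _
    have h2 : 0 ≤ ∫ x, max (ρ x - M) 0 := integral_nonneg hg0
    have h3 : ∫ x, max (ρ x - M) 0 = 0 := by
      have := hlog θ hθ
      nlinarith
    have h4 := (integral_eq_zero_iff_of_nonneg hg0 hgi).1 h3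
    refine ⟨hρ.1.isDensity.integrable.aestronglyMeasurable, ?_⟩
    filter_upwards [h4, hρ.1.isDensity.nonneg] with x hx hx0
    have h5 : ρ x - M ≤ max (ρ x - M) 0 := le_max_left _ _
    rw [hx] at h5
    simp only [Pi.zero_apply] at h5 hx0
    rw [abs_of_nonneg hx0]
    have : 0 < (L ^ d)⁻¹ := inv_pos.2 hN
    linarith
  · obtain ⟨σ, hσ, hσb, h⟩ := hρ.exists_truncation hW hs hK' hM h0
    refine ⟨σ, hσ, hσb, ?_⟩
    have h2 : 0 ≤ ∫ x, max (ρ x - M) 0 := integral_nonneg fun x => le_max_right _ _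
    have := mul_nonneg h2 (zero_le_one.trans (hlog θ hθ))
    linarith

end Density

end McKeanVlasov

/-! ### Weak compactness and existence of minimizers -/

namespace McKeanVlasov

section Compactness

variable {d : ℕ} {L : ℝ} [Fact (0 < L)] {W : Torus d L → ℝ} {C : ℝ}

/-- Sequential weak compactness of bounded sequences, with bounded test functions. -/
theorem exists_weak_limit_Lp (ρ : ℕ → Torus d L → ℝ) (hb : ∀ n, IsBoundedBy (ρ n) C) :
    ∃ φ : ℕ → ℕ, StrictMono φ ∧ ∃ r : Torus d L → ℝ, Integrable r ∧
      ∀ f : Torus d L → ℝ, MemLp f 2 volume →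
        Tendsto (fun n => ∫ x, f x * ρ (φ n) x) atTop (𝓝 (∫ x, f x * r x)) := by
  have hmem : ∀ n, MemLp (ρ n) 2 volume := fun n =>
    MemLp.of_bound (hb n).meas C (by simpa using (hb n).bound)
  set X : ℕ → Lp ℝ 2 (volume : Measure (Torus d L)) := fun n => (hmem n).toLp with hX
  obtain ⟨R, hR⟩ : ∃ R : ℝ, ∀ n, ‖X n‖ ≤ R := by
    refine ⟨_, fun n => Lp.norm_le_of_ae_bound (hb n).nonneg ?_⟩
    filter_upwards [(hmem n).coeFn_toLp, (hb n).bound] with x h1 h2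
    rw [h1]; exact h2
  have : Fact ((2 : ENNReal) ≠ ⊤) := ⟨by norm_num⟩
  -- Sequential Banach–Alaoglu in $L^2$, which is identified with its dual by Riesz.
  obtain ⟨a, -, φ, hφ, ha⟩ := WeakDual.isSeqCompact_closedBall ℝ
    (Lp ℝ 2 (volume : Measure (Torus d L))) 0 R
    (x := fun n => StrongDual.toWeakDual (InnerProductSpace.toDual ℝ _ (X n)))
    (fun n => by
      rw [Set.mem_preimage, mem_closedBall_zero_iff]
      exact ((InnerProductSpace.toDual ℝ _).norm_map (X n)).trans_le (hR n))
  set r := (InnerProductSpace.toDual ℝ (Lp ℝ 2 (volume : Measure (Torus d L)))).symm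
    (WeakDual.toStrongDual a) with hr
  refine ⟨φ, hφ, r, (Lp.memLp r).integrable (by norm_num), fun f hf => ?_⟩
  have h1 := (WeakDual.eval_continuous hf.toLp).seqContinuous ha
  have e1 : ∀ n, ∫ x, f x * ρ (φ n) x =
      (StrongDual.toWeakDual (InnerProductSpace.toDual ℝ _ (X (φ n)))) hf.toLp := by
    intro n
    change _ = inner ℝ (X (φ n)) hf.toLp
    rw [L2.inner_def]
    refine integral_congr_ae ?_
    filter_upwards [(hmem (φ n)).coeFn_toLp, hf.coeFn_toLp] with x h2 h3
    rw [h2, h3]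
    rfl
  have e2 : ∫ x, f x * r x = a hf.toLp := by
    have : a hf.toLp = inner ℝ r hf.toLp := by
      rw [← InnerProductSpace.toDual_apply_apply, hr, LinearIsometryEquiv.apply_symm_apply]
      rfl
    rw [this, L2.inner_def]
    refine integral_congr_ae ?_
    filter_upwards [hf.coeFn_toLp] with x h3
    rw [h3]
    rfl
  rw [e2]
  simp only [e1]
  exact h1

/-- Bounded sequences of densities are sequentially weakly compact. -/
theorem exists_weak_limit (ρ : ℕ → Torus d L → ℝ) (hd : ∀ n, IsDensity (ρ n))
    (hb : ∀ n, IsBoundedBy (ρ n) C) :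
    ∃ φ : ℕ → ℕ, StrictMono φ ∧ ∃ r : Torus d L → ℝ, IsDensity r ∧ IsBoundedBy r C ∧
      ∀ f : Torus d L → ℝ, Integrable f →
        Tendsto (fun n => ∫ x, f x * ρ (φ n) x) atTop (𝓝 (∫ x, f x * r x)) := by
  obtain ⟨φ, hφ, r, hr, h⟩ := exists_weak_limit_Lp ρ hb
  have hset : ∀ s : Set (Torus d L), MeasurableSet s →
      Tendsto (fun n => ∫ x in s, ρ (φ n) x) atTop (𝓝 (∫ x in s, r x)) := by
    intro s hs
    have e : ∀ q : Torus d L → ℝ, ∫ x, s.indicator (fun _ => (1 : ℝ)) x * q x = ∫ x in s, q x := by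
      intro q
      rw [← integral_indicator hs]
      congr 1
      ext x
      by_cases hx : x ∈ s <;> simp [hx]
    simpa only [e] using h _ ((memLp_const (1 : ℝ)).indicator hs)
  have hr0 : 0 ≤ᵐ[volume] r := ae_nonneg_of_forall_setIntegral_nonneg hr fun s hs _ =>
    ge_of_tendsto' (hset s hs) fun n =>
      setIntegral_nonneg_of_ae_restrict (ae_restrict_of_ae (hd _).nonneg)
  have hrC : r ≤ᵐ[volume] fun _ => C :=
    ae_le_of_forall_setIntegral_le hr (integrable_const C) fun s hs _ =>
      le_of_tendsto' (hset s hs) fun n => by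
        refine setIntegral_mono_ae (hd _).integrable.integrableOn (integrable_const C).integrableOn ?_
        filter_upwards [(hb (φ n)).bound] with x hx
        exact (le_abs_self _).trans hx
  have hr1 : ∫ x, r x = 1 := by
    have h1 := hset Set.univ MeasurableSet.univ
    simp only [setIntegral_univ, (hd _).integral_eq_one] at h1
    exact tendsto_nhds_unique h1 tendsto_const_nhds
  have hrb : IsBoundedBy r C := ⟨hr.aestronglyMeasurable, by
    filter_upwards [hr0, hrC] with x h1 h2
    rw [abs_of_nonneg h1]; exact h2⟩
  refine ⟨φ, hφ, r, ⟨hr, hr0, hr1⟩, hrb, fun f hf => ?_⟩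
  have hC := hrb.nonneg
  -- The common sup bound makes the pairings equicontinuous in $L^1$, so convergence extends from
  -- square integrable to all integrable test functions. The extension is needed because translates
  -- of the potential serve as test functions.
  have close : ∀ (q g : Torus d L → ℝ), IsBoundedBy q C → Integrable g →
      |(∫ x, f x * q x) - ∫ x, g x * q x| ≤ C * ∫ x, |f x - g x| := by
    intro q g hq hg
    have i1 : ∀ g : Torus d L → ℝ, Integrable g → Integrable fun x => g x * q x := fun g hg =>
      hg.mul_bdd (c := C) hq.meas (by simpa using hq.bound)
    rw [← integral_sub (i1 f hf) (i1 g hg), ← integral_const_mul, ← Real.norm_eq_abs]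
    refine norm_integral_le_of_norm_le ((hf.sub hg).abs.const_mul C) ?_
    filter_upwards [hq.bound] with x hx
    rw [← sub_mul, norm_mul, Real.norm_eq_abs, Real.norm_eq_abs, mul_comm]
    exact mul_le_mul_of_nonneg_right hx (abs_nonneg _)
  rw [Metric.tendsto_atTop]
  intro ε hε
  obtain ⟨g, hg, hgi⟩ := hf.exists_boundedContinuous_integral_sub_le
    (ε := ε / (4 * (C + 1))) (by positivity)
  have hgm : MemLp (g : Torus d L → ℝ) 2 volume :=
    MemLp.of_bound hgi.aestronglyMeasurable ‖g‖ (ae_of_all _ fun x => g.norm_coe_le_norm x)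
  obtain ⟨n₀, hn₀⟩ := Metric.tendsto_atTop.1 (h g hgm) (ε / 2) (by positivity)
  refine ⟨n₀, fun n hn => ?_⟩
  have h1 := close _ g (hb (φ n)) hgi
  have h2 := close _ g hrb hgi
  have h3 := hn₀ n hn
  have h4 : C * ∫ x, |f x - g x| ≤ ε / 4 := by
    calc C * ∫ x, |f x - g x| ≤ C * (ε / (4 * (C + 1))) := by gcongr; exact hg
      _ ≤ (C + 1) * (ε / (4 * (C + 1))) := by gcongr; linarith
      _ = ε / 4 := by field_simp
  rw [Real.dist_eq] at h3 ⊢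
  rw [abs_lt] at h3 ⊢
  rw [abs_le] at h1 h2
  constructor <;> linarith [h1.1, h1.2, h2.1, h2.2, h3.1, h3.2]

/-- The energy is continuous under weak convergence of bounded densities. -/
theorem tendsto_energy (hW : Integrable W) {ρ : ℕ → Torus d L → ℝ} {r : Torus d L → ℝ}
    (hb : ∀ n, IsBoundedBy (ρ n) C) (hr : IsBoundedBy r C)
    (h : ∀ f : Torus d L → ℝ, Integrable f →
        Tendsto (fun n => ∫ x, f x * ρ n x) atTop (𝓝 (∫ x, f x * r x))) :
    Tendsto (fun n => energy W (ρ n) (ρ n)) atTop (𝓝 (energy W r r)) := by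
  have hC := hr.nonneg
  -- Convolution with the kernel turns weak convergence into pointwise convergence, and dominated
  -- convergence upgrades this to $L^1$. What remains is a weak pairing with the fixed function `e
  -- r`.
  set e : (Torus d L → ℝ) → Torus d L → ℝ := fun q x => ∫ y, W (x - y) * q y with he
  have henergy : ∀ q, IsBoundedBy q C → energy W q q = ∫ x, e q x * q x := by
    intro q hq
    rw [energy, Measure.volume_eq_prod, integral_prod _ (integrable_kernel hW hq hq)]
    refine integral_congr_ae (ae_of_all _ fun x => ?_)
    simp only [he]
    rw [← integral_mul_const]
    congr 1
    ext y
    ring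
  have hWx : ∀ x, Integrable fun y => W (x - y) := fun x => hW.comp_sub_left x
  have heb : ∀ q, IsBoundedBy q C → IsBoundedBy (e q) (C * ∫ x, |W x|) := by
    intro q hq
    refine ⟨(integrable_kernel_snd hW hq.integrable).integral_prod_left.aestronglyMeasurable,
      ae_of_all _ fun x => ?_⟩
    have : ∫ y, |W y| = ∫ y, |W (x - y)| := (integral_sub_left_eq_self (fun y => |W y|) _ x).symm
    rw [this, ← integral_const_mul, ← Real.norm_eq_abs]
    refine norm_integral_le_of_norm_le ((hWx x).abs.const_mul C) ?_
    filter_upwards [hq.bound] with y hy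
    rw [norm_mul, Real.norm_eq_abs, Real.norm_eq_abs, mul_comm]
    exact mul_le_mul_of_nonneg_right hy (abs_nonneg _)
  have hpt : ∀ x, Tendsto (fun n => e (ρ n) x) atTop (𝓝 (e r x)) := fun x => h _ (hWx x)
  have hdct : Tendsto (fun n => ∫ x, |e (ρ n) x - e r x|) atTop (𝓝 0) := by
    suffices H : Tendsto (fun n => ∫ x, |e (ρ n) x - e r x|) atTop
        (𝓝 (∫ _ : Torus d L, (0 : ℝ))) by simpa using H
    refine tendsto_integral_of_dominated_convergence
      (fun _ => C * (∫ x, |W x|) + C * ∫ x, |W x|) ?_ (integrable_const _) ?_ ?_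
    · exact fun n => ((heb _ (hb n)).sub (heb _ hr)).abs.meas
    · exact fun n => by
        simpa using ((heb _ (hb n)).sub (heb _ hr)).bound
    · refine ae_of_all _ fun x => ?_
      simpa using ((hpt x).sub_const (e r x)).abs
  have h1 : Tendsto (fun n => ∫ x, e r x * ρ n x) atTop (𝓝 (∫ x, e r x * r x)) :=
    h _ (heb _ hr).integrable
  rw [henergy r hr]
  have h2 : Tendsto (fun n => energy W (ρ n) (ρ n) - ∫ x, e r x * ρ n x) atTop (𝓝 0) := by
    refine squeeze_zero_norm (a := fun n => C * ∫ x, |e (ρ n) x - e r x|) (fun n => ?_)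
      (by simpa using hdct.const_mul C)
    rw [henergy _ (hb n), ← integral_sub ((heb _ (hb n)).mul (hb n)).integrable
      ((heb _ hr).mul (hb n)).integrable, ← integral_const_mul]
    refine norm_integral_le_of_norm_le
      (((heb _ (hb n)).sub (heb _ hr)).abs.integrable.const_mul C) ?_
    filter_upwards [(hb n).bound] with x hx
    rw [← sub_mul, norm_mul, Real.norm_eq_abs, Real.norm_eq_abs, mul_comm]
    exact mul_le_mul_of_nonneg_right hx (abs_nonneg _)
  simpa using h2.add h1

/-- The entropy is lower semicontinuous under weak convergence of bounded densities. -/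
theorem entropy_le_of_tendsto {ρ : ℕ → Torus d L → ℝ} {r : Torus d L → ℝ}
    (hd : ∀ n, IsDensity (ρ n)) (hb : ∀ n, IsBoundedBy (ρ n) C)
    (hrd : IsDensity r) (hr : IsBoundedBy r C)
    (h : ∀ f : Torus d L → ℝ, Integrable f →
        Tendsto (fun n => ∫ x, f x * ρ n x) atTop (𝓝 (∫ x, f x * r x)))
    {s : ℝ} (hs : Tendsto (fun n => entropy (ρ n)) atTop (𝓝 s)) : entropy r ≤ s := by
  have hN := side_pow_pos d L
  have hC := hr.nonneg
  refine le_of_forall_pos_le_add fun ε hε => ?_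
  -- The tangent is taken at `r + δ`, since $\log r$ is unbounded where `r` is near zero; the shift
  -- has total mass `ε`.
  set δ := ε / L ^ d with hδ
  have hδ0 : 0 < δ := by positivity
  have hlb : IsBoundedBy (fun x => Real.log (r x + δ)) (|Real.log δ| + |Real.log (C + δ)|) := by
    refine ⟨(Real.measurable_log.comp_aemeasurable
      (hr.meas.aemeasurable.add_const δ)).aestronglyMeasurable, ?_⟩
    filter_upwards [hr.bound, hrd.nonneg] with x h1 h2
    simp only [Pi.zero_apply] at h2
    have h3 : Real.log δ ≤ Real.log (r x + δ) := Real.log_le_log hδ0 (by linarith)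
    have h4 : Real.log (r x + δ) ≤ Real.log (C + δ) :=
      Real.log_le_log (by linarith) (by linarith [le_abs_self (r x)])
    rw [abs_le]
    constructor
    · linarith [neg_abs_le (Real.log δ), abs_nonneg (Real.log (C + δ))]
    · linarith [le_abs_self (Real.log (C + δ)), abs_nonneg (Real.log δ)]
  have hlow : ∀ n, (∫ x, Real.log (r x + δ) * ρ n x) - ε ≤ entropy (ρ n) := by
    intro n
    obtain ⟨D, hD⟩ := (hb n).mul_log
    have i1 := (hlb.mul (hb n)).integrable
    have i2 : Integrable fun x => ρ n x - (r x + δ) :=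
      (hd n).integrable.sub (hrd.integrable.add (integrable_const _))
    have : (∫ x, Real.log (r x + δ) * ρ n x) - ε =
        ∫ x, (Real.log (r x + δ) * ρ n x + (ρ n x - (r x + δ))) := by
      rw [integral_add i1 i2, integral_sub (hd n).integrable
        (hrd.integrable.fun_add (integrable_const _)),
        integral_add hrd.integrable (integrable_const _), (hd n).integral_eq_one,
        hrd.integral_eq_one, integral_const_torus, show L ^ d * δ = ε by rw [hδ]; field_simp]
      ring
    rw [this, entropy]
    refine integral_mono_ae (i1.add i2) hD.integrable ?_
    filter_upwards [hrd.nonneg, (hd n).nonneg] with x h1 h2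
    have := tangent_le_mul_log h2 (show 0 < r x + δ from add_pos_of_nonneg_of_pos h1 hδ0)
    linarith
  have h1 := le_of_tendsto_of_tendsto' ((h _ hlb.integrable).sub_const ε) hs hlow
  obtain ⟨D, hD⟩ := hr.mul_log
  have h2 : entropy r ≤ ∫ x, Real.log (r x + δ) * r x := by
    refine integral_mono_ae hD.integrable (hlb.mul hr).integrable ?_
    filter_upwards [hrd.nonneg] with x hx
    rcases (show 0 ≤ r x from hx).eq_or_lt with h0 | h0
    · simp [← h0]
    · have := Real.log_le_log h0 (show r x ≤ r x + δ by linarith)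
      rw [mul_comm (Real.log _)]
      gcongr
  linarith

/-- Weak limit of bounded densities along which both parts of the free energy behave well. -/
theorem exists_limit_density (hW : Integrable W) (ρ : ℕ → Torus d L → ℝ)
    (hd : ∀ n, IsDensity (ρ n)) (hb : ∀ n, IsBoundedBy (ρ n) C) :
    ∃ φ : ℕ → ℕ, StrictMono φ ∧ ∃ (r : Torus d L → ℝ) (s : ℝ), IsDensity r ∧ IsBoundedBy r C ∧
      Tendsto (fun n => energy W (ρ (φ n)) (ρ (φ n))) atTop (𝓝 (energy W r r)) ∧
      Tendsto (fun n => entropy (ρ (φ n))) atTop (𝓝 s) ∧ entropy r ≤ s := by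
  obtain ⟨φ, hφ, r, hrd, hrb, h⟩ := exists_weak_limit ρ hd hb
  obtain ⟨D, hD⟩ := (isCompact_Icc (a := -C) (b := C)).exists_bound_of_continuousOn
    continuous_mul_log.continuousOn
  have hbd : ∀ n, entropy (ρ (φ n)) ∈ Set.Icc (-(D * L ^ d)) (D * L ^ d) := by
    intro n
    rw [Set.mem_Icc, ← abs_le, ← Real.norm_eq_abs,
      ← volume_real_torus (d := d)]
    refine norm_integral_le_of_norm_le_const ?_
    filter_upwards [(hb (φ n)).bound] with x hx
    exact hD _ (abs_le.1 hx)
  obtain ⟨s, -, ψ, hψ, hs⟩ := isCompact_Icc.isSeqCompact hbd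
  have h' : ∀ f : Torus d L → ℝ, Integrable f →
      Tendsto (fun n => ∫ x, f x * ρ (φ (ψ n)) x) atTop (𝓝 (∫ x, f x * r x)) := fun f hf =>
    (h f hf).comp hψ.tendsto_atTop
  exact ⟨φ ∘ ψ, hφ.comp hψ, r, s, hrd, hrb, tendsto_energy hW (fun n => hb _) hrb h', hs,
    entropy_le_of_tendsto (fun n => hd _) (fun n => hb _) hrd hrb h' hs⟩

/-- The free energy attains its infimum. -/
theorem exists_isMinimizer (hW : Integrable W) (hs : ∀ x, W (-x) = W x) {K : ℝ}
    (hK : ∀ᵐ x, -K ≤ W x) {θ : ℝ} (hθ : 0 ≤ θ) : ∃ ρ, IsMinimizer W θ ρ := by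
  have hN := side_pow_pos d L
  obtain ⟨M, hM⟩ := exists_uniform_bound hW hs hK θ
  obtain ⟨-, hM⟩ := hM θ hθ le_rfl
  -- Restricting to densities with the common bound `M` loses nothing and makes the direct method
  -- applicable.
  set S : Set ℝ := {t | ∃ σ, IsDensity σ ∧ IsBoundedBy σ M ∧ t = freeEnergy W θ σ} with hS
  have hne : S.Nonempty := by
    obtain ⟨σ, h1, h2, -⟩ := hM _ (isAdmissible_uniform hW)
    exact ⟨_, σ, h1, h2, rfl⟩
  have hbdd : BddBelow S := by
    refine ⟨entropy (uniformDensity d L) - 1 / 2 * θ * L ^ d *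
      ((∫ x, |W x|) * (M * 1)), ?_⟩
    rintro _ ⟨σ, h1, h2, rfl⟩
    have h3 := h1.entropy_uniform_le (h1.isAdmissible h2 hW).entropy_finite
    have h4 := abs_energy_le hW hs h2
    have h5 : ∫ x, σ x ^ 2 ≤ M * 1 := by
      rw [← h1.integral_eq_one, ← integral_const_mul]
      refine integral_mono_ae h2.integrable_sq (h1.integrable.const_mul M) ?_
      filter_upwards [h1.nonneg, h2.bound] with x hx hx2
      simp only [sq]
      exact mul_le_mul_of_nonneg_right ((le_abs_self _).trans hx2) hx
    have h6 : 0 ≤ ∫ x, |W x| := integral_nonneg fun _ => abs_nonneg _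
    have h7 : -((∫ x, |W x|) * (M * 1)) ≤ energy W σ σ := by
      have := neg_abs_le (energy W σ σ)
      have := mul_le_mul_of_nonneg_left h5 h6
      linarith
    have h8 : 1 / 2 * θ * L ^ d * (-((∫ x, |W x|) * (M * 1))) ≤
      1 / 2 * θ * L ^ d * energy W σ σ := by gcongr
    unfold freeEnergy
    linarith
  obtain ⟨u, -, hu, huS⟩ := exists_seq_tendsto_sInf hne hbdd
  choose ρ hρd hρb hρu using huS
  obtain ⟨φ, hφ, r, s, hrd, hrb, hE, hent, hle⟩ := exists_limit_density hW ρ hρd hρb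
  refine ⟨r, hrd.isAdmissible hrb hW, fun σ hσ => ?_⟩
  obtain ⟨τ, h1, h2, h3⟩ := hM σ hσ
  refine le_trans ?_ h3
  have h4 : sInf S ≤ freeEnergy W θ τ := csInf_le hbdd ⟨τ, h1, h2, rfl⟩
  have h5 : Tendsto (fun n => freeEnergy W θ (ρ (φ n))) atTop
      (𝓝 (s + 1 / 2 * θ * L ^ d * energy W r r)) := hent.add (hE.const_mul _)
  have h6 : Tendsto (fun n => freeEnergy W θ (ρ (φ n))) atTop (𝓝 (sInf S)) := by
    simpa only [← hρu, Function.comp_def] using hu.comp hφ.tendsto_atTop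
  have h7 := tendsto_nhds_unique h5 h6
  unfold freeEnergy at h4 ⊢
  linarith

end Compactness

end McKeanVlasov

/-! ### Local stability of the uniform density -/

namespace McKeanVlasov

section Stability

variable {d : ℕ} {L : ℝ} [Fact (0 < L)] {W ρ : Torus d L → ℝ} {C : ℝ}

/-- The properties of the torus potential behind the transition: `w < 0` is a lower bound of the
energy form with respect to the `L²` norm. -/
structure IsCoercive (W : Torus d L → ℝ) (w : ℝ) : Prop where
  integrable : Integrable W volume
  even : ∀ x, W (-x) = W x
  bounded_below : ∃ K : ℝ, ∀ᵐ x, -K ≤ W x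
  neg : w < 0
  le_energy : ∀ f C, IsBoundedBy f C → w * ∫ x, f x ^ 2 ≤ energy W f f

theorem continuous_entropyGap : Continuous entropyGap := by
  have h : entropyGap = fun t => (1 + t) * Real.log (1 + t) - t := rfl
  rw [h]
  exact (Real.continuous_mul_log.comp (continuous_const.add continuous_id)).sub continuous_id

theorem entropyGap_zero : entropyGap 0 = 0 := by simp [entropyGap]

theorem IsBoundedBy.integrable_entropyGap {t : Torus d L → ℝ} (ht : IsBoundedBy t C) :
    Integrable fun x => entropyGap (t x) := by
  obtain ⟨D, hD⟩ := (isCompact_Icc (a := -C) (b := C)).exists_bound_of_continuousOn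
    continuous_entropyGap.continuousOn
  refine Integrable.of_bound (continuous_entropyGap.comp_aestronglyMeasurable ht.meas) D ?_
  filter_upwards [ht.bound] with x hx
  exact hD _ (abs_le.1 hx)

/-- The relative fluctuation `L ^ d ρ - 1` of a density. -/
def fluctuation (ρ : Torus d L → ℝ) : Torus d L → ℝ := fun x => L ^ d * ρ x - 1

theorem IsBoundedBy.fluctuation (h : IsBoundedBy ρ C) :
    IsBoundedBy (fluctuation ρ) (L ^ d * C + 1) := by
  have hN := side_pow_pos d L
  have h1 := (h.const_mul (L ^ d)).sub (IsBoundedBy.const 1)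
  rwa [abs_of_pos hN, abs_one] at h1

theorem fluctuation_eq_zero_iff :
    fluctuation ρ =ᵐ[volume] (fun _ => 0) ↔ ρ =ᵐ[volume] uniformDensity d L := by
  have hN := side_pow_pos d L
  refine ⟨fun h => h.mono fun x hx => ?_, fun h => h.mono fun x hx => ?_⟩
  · simp only [McKeanVlasov.fluctuation, sub_eq_zero] at hx
    exact eq_inv_of_mul_eq_one_right hx
  · simp only [McKeanVlasov.fluctuation, hx, uniformDensity]
    field_simp
    simp

/-- Convolving the kernel with a constant gives a constant and densities have mass one, so the cross
terms reduce to the uniform energy. The expansion about the uniform state thus has no linear term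
and is exact. -/
theorem IsDensity.freeEnergy_sub (hW : Integrable W) (hs : ∀ x, W (-x) = W x)
    (h : IsDensity ρ) (hb : IsBoundedBy ρ C) (θ : ℝ) :
    L ^ d * (freeEnergy W θ ρ - freeEnergy W θ (uniformDensity d L)) =
      (∫ x, entropyGap (fluctuation ρ x)) +
        θ / 2 * energy W (fluctuation ρ) (fluctuation ρ) := by
  have hN := side_pow_pos d L
  have h1 := h.integral_gap (h.isAdmissible hb hW).entropy_finite
  have h2 : energy W (fluctuation ρ) (fluctuation ρ) =
      (L ^ d) ^ 2 * energy W ρ ρ - L ^ d * ∫ x, W x := by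
    have e : fluctuation ρ = fun x => L ^ d * ρ x + (-1) * (1 : ℝ) := by
      ext x; simp [fluctuation]; ring
    rw [e, energy_add_self hW hs (hb.const_mul _) ((IsBoundedBy.const 1).const_mul _),
      energy_const_mul, energy_const_mul, energy_const_mul, energy_one_right hW hs h.integrable,
      energy_one_right hW hs (integrable_const 1), h.integral_eq_one, integral_const_torus]
    ring
  have e3 : (∫ x, entropyGap (fluctuation ρ x)) = ∫ x, entropyGap (L ^ d * ρ x - 1) := rfl
  rw [e3, h1, h2, freeEnergy, freeEnergy, energy_uniform hW]
  field_simp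
  ring

theorem integral_sq_pos {t : Torus d L → ℝ} (ht : IsBoundedBy t C)
    (h0 : ¬ t =ᵐ[volume] fun _ => 0) : 0 < ∫ x, t x ^ 2 := by
  have h1 : 0 ≤ ∫ x, t x ^ 2 := integral_nonneg fun x => sq_nonneg _
  rcases h1.eq_or_lt with h2 | h2
  · refine absurd ?_ h0
    have h3 := (integral_eq_zero_iff_of_nonneg (fun x => sq_nonneg _) ht.integrable_sq).1 h2.symm
    filter_upwards [h3] with x hx
    exact pow_eq_zero_iff (two_ne_zero) |>.1 hx
  · exact h2

theorem integral_entropyGap_ge {t : Torus d L → ℝ} (ht : IsBoundedBy t C)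
    (h1 : ∀ᵐ x, -1 ≤ t x) : (4 + 2 * C)⁻¹ * ∫ x, t x ^ 2 ≤ ∫ x, entropyGap (t x) := by
  rw [← integral_const_mul]
  refine integral_mono_ae (ht.integrable_sq.const_mul _) ht.integrable_entropyGap ?_
  filter_upwards [h1, ht.bound] with x hx hx2
  have := le_entropyGap hx ((le_abs_self _).trans hx2)
  rwa [div_eq_inv_mul] at this

/-- At weak coupling the uniform density is a minimizer among bounded densities. -/
theorem free_energy_nonneg_of_small {t : Torus d L → ℝ} (hW : Integrable W)
    (hs : ∀ x, W (-x) = W x) (ht : IsBoundedBy t C)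
    (h1 : ∀ᵐ x, -1 ≤ t x) {θ : ℝ} (hθ : 0 ≤ θ)
    (hθ' : θ / 2 * (∫ x, |W x|) ≤ (4 + 2 * C)⁻¹) :
    0 ≤ (∫ x, entropyGap (t x)) + θ / 2 * energy W t t := by
  have h2 := integral_entropyGap_ge ht h1
  have h3 := abs_energy_le hW hs ht
  have h4 : 0 ≤ ∫ x, t x ^ 2 := integral_nonneg fun x => sq_nonneg _
  have h5 : θ / 2 * (-((∫ x, |W x|) * ∫ x, t x ^ 2)) ≤ θ / 2 * energy W t t := by
    gcongr
    linarith [neg_abs_le (energy W t t)]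
  have h6 := mul_le_mul_of_nonneg_right hθ' h4
  linarith

/-- Below the linear instability threshold the uniform density is a strict local minimizer in `L¹`
among bounded densities. -/
theorem IsCoercive.exists_local_stability {w : ℝ} (hc : IsCoercive W w) {Θ : ℝ} (hΘ : 0 < Θ)
    (hΘw : 0 < 1 + Θ * w) {T : ℝ} (hT : 0 ≤ T) :
    ∃ ε > 0, ∀ θ, 0 ≤ θ → θ ≤ Θ → ∀ t : Torus d L → ℝ, IsBoundedBy t T → (∀ᵐ x, -1 ≤ t x) →
      (∫ x, |t x|) < ε → ¬ t =ᵐ[volume] (fun _ => 0) →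
        0 < (∫ x, entropyGap (t x)) + θ / 2 * energy W t t := by
  have hW := hc.integrable
  have hs := hc.even
  have hw := hc.neg
  set q := 1 + Θ * w with hq
  have hq1 : q ≤ 1 := by nlinarith
  -- Threshold between small and large fluctuation values. Where $|t|\le s$ the entropy is at least
  -- $(1-s)t^2/2$, and subtracting the worst energy leaves a coefficient $(q-s)/2\ge q/4$.
  set s := q / 20 with hs'
  have hs0 : 0 < s := by positivity
  have hs1 : s ≤ 1 / 20 := by linarith
  set c := (4 + 2 * T)⁻¹ with hcdef
  have hc0 : 0 < c := by positivity
  obtain ⟨B, hB⟩ : ∃ B : ℕ, 2 * T * (∫ x, max (|W x| - B) 0) ≤ c * s / (2 * Θ) := by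
    have h := (tendsto_integral_cutoff hW).const_mul (2 * T)
    rw [mul_zero] at h
    exact (h.eventually (ge_mem_nhds (show 0 < c * s / (2 * Θ) by positivity))).exists
  -- Chosen so that the kernel below height `B` contributes at most $cs/(2\Theta)$ to `κ`; the
  -- choice of `B` bounds the tail's contribution by the same amount.
  refine ⟨c * s / (4 * Θ * (B + 1)), by positivity, fun θ hθ0 hθ t ht ht1 htε htne => ?_⟩
  set t1 : Torus d L → ℝ := fun x => if |t x| ≤ s then t x else 0 with ht1def
  set t2 : Torus d L → ℝ := fun x => if |t x| ≤ s then 0 else t x with ht2def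
  have hsum : ∀ x, t x = t1 x + t2 x := fun x => by
    simp only [ht1def, ht2def]; split_ifs <;> simp
  have hmeas : AEMeasurable t volume := ht.meas.aemeasurable
  have hφ1 : Measurable fun u : ℝ => if |u| ≤ s then u else 0 :=
    Measurable.ite (measurableSet_le measurable_id.abs measurable_const) measurable_id
      measurable_const
  have hφ2 : Measurable fun u : ℝ => if |u| ≤ s then 0 else u :=
    Measurable.ite (measurableSet_le measurable_id.abs measurable_const)
      measurable_const measurable_id
  have hb1 : IsBoundedBy t1 T := by
    refine ⟨(hφ1.comp_aemeasurable hmeas).aestronglyMeasurable, ht.bound.mono fun x hx => ?_⟩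
    simp only [ht1def]; split_ifs
    · exact hx
    · simpa using hT
  have hb2 : IsBoundedBy t2 T := by
    refine ⟨(hφ2.comp_aemeasurable hmeas).aestronglyMeasurable, ht.bound.mono fun x hx => ?_⟩
    simp only [ht2def]; split_ifs
    · simpa using hT
    · exact hx
  -- The cross term and the self-energy of `t2` are grouped together, as $2t_1+t_2=t_1+t$; the
  -- second factor is small in $L^1$.
  have hE : energy W t t = energy W t1 t1 + energy W t2 (fun x => t1 x + t x) := by
    have e : t = fun x => t1 x + t2 x := funext hsum
    rw [energy_add_right hW hb1 ht hb2]
    conv_lhs => rw [e]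
    conv_rhs => rw [e]
    rw [energy_add_self hW hs hb1 hb2, energy_add_right hW hb1 hb2 hb2,
      energy_comm hs (f := t2) (g := t1)]
    ring
  have hgap : ∀ x, entropyGap (t x) = entropyGap (t1 x) + entropyGap (t2 x) := fun x => by
    simp only [ht1def, ht2def]; split_ifs <;> simp [entropyGap_zero]
  have hsq : ∀ x, t x ^ 2 = t1 x ^ 2 + t2 x ^ 2 := fun x => by
    simp only [ht1def, ht2def]; split_ifs <;> simp
  have hE1 := hc.le_energy t1 T hb1
  have hG1 : (1 - s) / 2 * ∫ x, t1 x ^ 2 ≤ ∫ x, entropyGap (t1 x) := by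
    rw [← integral_const_mul]
    refine integral_mono (hb1.integrable_sq.const_mul _) hb1.integrable_entropyGap fun x => ?_
    have hx : |t1 x| ≤ s := by
      simp only [ht1def]; split_ifs with h
      · exact h
      · simpa using hs0.le
    simp only
    set u := t1 x
    have h1 := (abs_le.1 (abs_entropyGap_sub_le (t := u) (by linarith))).1
    have h2 : u ^ 2 ≤ s ^ 2 := by rw [← sq_abs]; gcongr
    have h3 := abs_le.1 hx
    have h4 : u ^ 2 * u ≤ u ^ 2 * s := by gcongr; exact h3.2
    have h5 : u ^ 2 * u ^ 2 ≤ u ^ 2 * s ^ 2 := by gcongr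
    have h6 : u ^ 2 * s ^ 2 ≤ u ^ 2 * (s * (1 / 20)) := by
      rw [sq s]; gcongr
    have h7 : 0 ≤ u ^ 2 * s := by positivity
    nlinarith
  have hpt2 : ∀ᵐ x, -1 ≤ t2 x := ht1.mono fun x hx => by
    simp only [ht2def]; split_ifs
    · norm_num
    · exact hx
  have hG2 := integral_entropyGap_ge hb2 hpt2
  -- Large values exceed `s`, so the $L^1$ norm produced by the cutoff estimate is absorbed by the
  -- entropy of the large part.
  have hL2 : s * ∫ x, |t2 x| ≤ ∫ x, t2 x ^ 2 := by
    rw [← integral_const_mul]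
    refine integral_mono (hb2.abs.integrable.const_mul _) hb2.integrable_sq fun x => ?_
    simp only [ht2def]; split_ifs with h
    · simp
    · rw [← sq_abs, sq]
      exact mul_le_mul_of_nonneg_right (not_le.1 h).le (abs_nonneg _)
  have hL1 : ∫ x, |t1 x + t x| ≤ 2 * ∫ x, |t x| := by
    rw [← integral_const_mul]
    refine integral_mono (hb1.add ht).abs.integrable (ht.abs.integrable.const_mul _) fun x => ?_
    simp only [ht1def]; split_ifs
    · rw [← two_mul, abs_mul]; simp
    · rw [zero_add]; linarith [abs_nonneg (t x)]
  have hcut := abs_energy_le_cutoff hW hs hb2 (hb1.add ht) B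
  set κ := (B : ℝ) * (∫ x, |t1 x + t x|) + (T + T) * ∫ x, max (|W x| - B) 0 with hκ
  have hκle : Θ * κ ≤ c * s := by
    have h1 : (B : ℝ) * (∫ x, |t1 x + t x|) ≤ (B + 1) * (2 * (c * s / (4 * Θ * (B + 1)))) := by
      have h0 : 0 ≤ ∫ x, |t1 x + t x| := integral_nonneg fun _ => abs_nonneg _
      refine mul_le_mul (by linarith) (hL1.trans (by linarith)) h0 (by positivity)
    have h2 : ((B : ℝ) + 1) * (2 * (c * s / (4 * Θ * (B + 1)))) = c * s / (2 * Θ) := by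
      field_simp; ring
    have h3 : κ ≤ c * s / Θ := by
      have : c * s / Θ = c * s / (2 * Θ) + c * s / (2 * Θ) := by field_simp; ring
      rw [hκ, this]
      linarith
    calc Θ * κ ≤ Θ * (c * s / Θ) := by gcongr
      _ = c * s := by field_simp
  have hn1 : 0 ≤ ∫ x, t1 x ^ 2 := integral_nonneg fun x => sq_nonneg _
  have hn2 : 0 ≤ ∫ x, t2 x ^ 2 := integral_nonneg fun x => sq_nonneg _
  have hn3 : 0 ≤ ∫ x, |t2 x| := integral_nonneg fun x => abs_nonneg _
  have hpos := integral_sq_pos ht htne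
  simp only [hsq] at hpos
  rw [integral_add hb1.integrable_sq hb2.integrable_sq] at hpos
  simp only [hgap]
  rw [integral_add hb1.integrable_entropyGap hb2.integrable_entropyGap, hE]
  have f1 : θ / 2 * (w * ∫ x, t1 x ^ 2) ≤ θ / 2 * energy W t1 t1 := by gcongr
  have f2 : θ * (-w) * (∫ x, t1 x ^ 2) ≤ Θ * (-w) * ∫ x, t1 x ^ 2 := by
    gcongr; linarith
  have hκ0 : 0 ≤ κ := by
    have h0 : 0 ≤ ∫ x, |t1 x + t x| := integral_nonneg fun _ => abs_nonneg _
    have h1 : 0 ≤ ∫ x, max (|W x| - B) 0 := integral_nonneg fun _ => le_max_right _ _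
    positivity
  have f3 : θ * (κ * ∫ x, |t2 x|) ≤ c * ∫ x, t2 x ^ 2 := by
    calc θ * (κ * ∫ x, |t2 x|) ≤ Θ * (κ * ∫ x, |t2 x|) := by gcongr
      _ = (Θ * κ) * ∫ x, |t2 x| := by ring
      _ ≤ c * s * ∫ x, |t2 x| := by gcongr
      _ = c * (s * ∫ x, |t2 x|) := by ring
      _ ≤ _ := by gcongr
  have f4 : θ * (-(κ * ∫ x, |t2 x|)) ≤ θ * energy W t2 (fun x => t1 x + t x) := by
    gcongr
    linarith [neg_abs_le (energy W t2 (fun x => t1 x + t x))]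
  have f5 : 0 < q / 4 * (∫ x, t1 x ^ 2) + c / 2 * ∫ x, t2 x ^ 2 := by
    rcases hn1.eq_or_lt with h | h
    · rw [← h] at hpos ⊢
      have : 0 < ∫ x, t2 x ^ 2 := by linarith
      positivity
    · positivity
  have f6 : q / 4 * (∫ x, t1 x ^ 2) ≤ ((1 - s) / 2 + Θ * w / 2) * ∫ x, t1 x ^ 2 := by
    gcongr
    linarith
  linarith

end Stability

end McKeanVlasov

/-! ### The end of the uniform phase -/

namespace McKeanVlasov

section Transition

variable {d : ℕ} {L : ℝ} [Fact (0 < L)] {W ρ σ : Torus d L → ℝ} {C θ : ℝ}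

theorem entropy_congr (h : ρ =ᵐ[volume] σ) : entropy ρ = entropy σ :=
  integral_congr_ae (h.mono fun x hx => by simp only [hx])

theorem freeEnergy_congr (h : ρ =ᵐ[volume] σ) : freeEnergy W θ ρ = freeEnergy W θ σ := by
  rw [freeEnergy, freeEnergy, entropy_congr h, energy_congr h h]

/-- The set of couplings at which the uniform density is a minimizer. -/
def uniformPhase (W : Torus d L → ℝ) : Set ℝ :=
  {θ | 0 ≤ θ ∧ ∀ ρ, IsAdmissible W ρ → freeEnergy W θ (uniformDensity d L) ≤ freeEnergy W θ ρ}

theorem IsMinimizer.mem_uniformPhase (hρ : IsMinimizer W θ ρ) (hθ : 0 ≤ θ)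
    (h : ρ =ᵐ[volume] uniformDensity d L) : θ ∈ uniformPhase W :=
  ⟨hθ, fun σ hσ => by rw [← freeEnergy_congr h]; exact hρ.2 σ hσ⟩

theorem isMinimizer_uniform (hW : Integrable W) (h : θ ∈ uniformPhase W) :
    IsMinimizer W θ (uniformDensity d L) :=
  ⟨isAdmissible_uniform hW, h.2⟩

/-- The uniform state has least entropy. A competitor can win only through lower energy, and that
advantage shrinks with the coupling. -/
theorem uniformPhase_of_le {θ' : ℝ} (h : θ ∈ uniformPhase W) (h0 : 0 ≤ θ') (hle : θ' ≤ θ) :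
    θ' ∈ uniformPhase W := by
  have hN := side_pow_pos d L
  refine ⟨h0, fun ρ hρ => ?_⟩
  have h1 := h.2 ρ hρ
  have h2 := hρ.isDensity.entropy_uniform_le hρ.entropy_finite
  unfold freeEnergy at h1 ⊢
  set E := energy W ρ ρ
  set E₀ := energy W (uniformDensity d L) (uniformDensity d L)
  rcases le_total E₀ E with h3 | h3
  · have : 1 / 2 * θ' * L ^ d * E₀ ≤ 1 / 2 * θ' * L ^ d * E := by gcongr
    linarith
  · have : 1 / 2 * θ' * L ^ d * (E₀ - E) ≤ 1 / 2 * θ * L ^ d * (E₀ - E) := by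
      have := sub_nonneg.2 h3
      gcongr
    linarith

/-- For each fixed competitor the free energy is affine in the coupling, so its constraint is
closed. -/
theorem isClosed_uniformPhase (W : Torus d L → ℝ) : IsClosed (uniformPhase W) := by
  have : uniformPhase W = Set.Ici 0 ∩ ⋂ ρ, ⋂ (_ : IsAdmissible W ρ),
      {θ | freeEnergy W θ (uniformDensity d L) ≤ freeEnergy W θ ρ} := by
    ext θ
    simp [uniformPhase]
  rw [this]
  refine isClosed_Ici.inter (isClosed_iInter fun ρ => isClosed_iInter fun _ =>
    isClosed_le ?_ ?_) <;> unfold freeEnergy <;> fun_prop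

/-- Strictly inside the uniform phase the uniform density is the only minimizer. -/
theorem uniformIsUniqueMinimizer_of_lt (hW : Integrable W) {θ' : ℝ} (h : θ ∈ uniformPhase W)
    (h0 : 0 ≤ θ') (hlt : θ' < θ) : UniformIsUniqueMinimizer W θ' := by
  have hN := side_pow_pos d L
  refine ⟨isMinimizer_uniform hW (uniformPhase_of_le h h0 hlt.le), fun ρ hρ => ?_⟩
  by_contra hne
  have h1 := hρ.2 _ (isAdmissible_uniform hW)
  have h2 := hρ.1.isDensity.entropy_uniform_lt hρ.1.entropy_finite hne
  have h3 := h.2 ρ hρ.1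
  unfold freeEnergy at h1 h3
  set E := energy W ρ ρ
  set E₀ := energy W (uniformDensity d L) (uniformDensity d L)
  rcases le_total E₀ E with h4 | h4
  · have : 1 / 2 * θ' * L ^ d * E₀ ≤ 1 / 2 * θ' * L ^ d * E := by gcongr
    linarith
  · rcases h4.eq_or_lt with h5 | h5
    · rw [h5] at h1; linarith
    · have h6 : 1 / 2 * θ' * L ^ d * (E₀ - E) < 1 / 2 * θ * L ^ d * (E₀ - E) := by
        have := sub_pos.2 h5
        gcongr
      by_contra
      nlinarith

/-- A nontrivial density pays strictly in entropy, so a minimizer must recover this in energy. -/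
theorem IsNontrivialMinimizer.energy_lt (hW : Integrable W) (hρ : IsNontrivialMinimizer W θ ρ)
    (hθ : 0 ≤ θ) :
    energy W ρ ρ < energy W (uniformDensity d L) (uniformDensity d L) := by
  have hN := side_pow_pos d L
  have h1 := hρ.1.2 _ (isAdmissible_uniform hW)
  have h2 := hρ.1.1.isDensity.entropy_uniform_lt hρ.1.1.entropy_finite hρ.2
  by_contra! h3
  have : 1 / 2 * θ * L ^ d * energy W (uniformDensity d L) (uniformDensity d L) ≤
    1 / 2 * θ * L ^ d * energy W ρ ρ := by gcongr
  unfold freeEnergy at h1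
  linarith

variable {w : ℝ}

/-- At weak coupling the uniform density is a minimizer. -/
theorem IsCoercive.exists_pos_mem_uniformPhase (hc : IsCoercive W w) :
    ∃ θ₁ > 0, θ₁ ∈ uniformPhase W := by
  have hN := side_pow_pos d L
  have hW := hc.integrable
  obtain ⟨K, hK⟩ := hc.bounded_below
  obtain ⟨M, hM⟩ := exists_uniform_bound hW hc.even hK 1
  have hM0 : 0 ≤ M := by
    obtain ⟨σ, -, h2, -⟩ := (hM 0 le_rfl zero_le_one).2 _ (isAdmissible_uniform hW)
    exact h2.nonneg
  set T := L ^ d * M + 1 with hT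
  have hT0 : 0 ≤ T := by positivity
  have hWn : 0 ≤ ∫ x, |W x| := integral_nonneg fun _ => abs_nonneg _
  -- The cap 1 matches the range for which `M` was chosen; the other term lets the quadratic lower
  -- bound on entropy dominate the energy.
  set θ₁ := min 1 ((4 + 2 * T)⁻¹ / ((∫ x, |W x|) + 1)) with hθ₁
  have hpos : 0 < θ₁ := by positivity
  refine ⟨θ₁, hpos, hpos.le, fun ρ hρ => ?_⟩
  obtain ⟨σ, h1, h2, h3⟩ := (hM θ₁ hpos.le (min_le_left _ _)).2 ρ hρ
  refine le_trans ?_ h3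
  have h4 := free_energy_nonneg_of_small hW hc.even h2.fluctuation h1.neg_one_le hpos.le (by
    calc θ₁ / 2 * (∫ x, |W x|) ≤ θ₁ * ((∫ x, |W x|) + 1) := by nlinarith
      _ ≤ (4 + 2 * T)⁻¹ / ((∫ x, |W x|) + 1) * ((∫ x, |W x|) + 1) := by
        gcongr; exact min_le_right _ _
      _ = (4 + 2 * T)⁻¹ := div_mul_cancel₀ _ (by positivity))
  rw [← h1.freeEnergy_sub hW hc.even h2] at h4
  have := (mul_nonneg_iff_of_pos_left hN).1 h4
  linarith

/-- Below the linear threshold nontrivial minimizers stay away from the uniform density, in `L¹`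
and in entropy. -/
theorem IsCoercive.exists_separation (hc : IsCoercive W w) {Θ : ℝ} (hΘ : 0 < Θ)
    (hΘw : 0 < 1 + Θ * w) :
    ∃ M : ℝ, ∃ ε > 0, ∀ θ, 0 ≤ θ → θ ≤ Θ → ∀ ρ, IsNontrivialMinimizer W θ ρ →
      IsBoundedBy ρ M ∧ ε ≤ (∫ x, |uniformDensity d L x - ρ x|) ∧
        entropy (uniformDensity d L) + ε ≤ entropy ρ := by
  have hN := side_pow_pos d L
  have hW := hc.integrable
  obtain ⟨K, hK⟩ := hc.bounded_below
  obtain ⟨M, hM⟩ := exists_uniform_bound hW hc.even hK Θ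
  have hM0 : 0 ≤ M := by
    obtain ⟨σ, -, h2, -⟩ := (hM 0 le_rfl hΘ.le).2 _ (isAdmissible_uniform hW)
    exact h2.nonneg
  set N := L ^ d with hNdef
  set T := N * M + 1 with hT
  have hT0 : 0 ≤ T := by positivity
  obtain ⟨ε, hε, hstab⟩ := hc.exists_local_stability hΘ hΘw hT0
  set c := (4 + 2 * T)⁻¹ with hcd
  have hc0 : 0 < c := by positivity
  -- The first term rescales the $L^1$ distance from fluctuations to densities; the second converts
  -- that distance into an entropy gap.
  refine ⟨M, min (ε / N) (c * (ε ^ 2 / N) / N), by positivity, fun θ h0 h1 ρ hρ => ?_⟩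
  have hb := (hM θ h0 h1).1 ρ hρ.1
  have hd := hρ.1.1.isDensity
  have ht : IsBoundedBy (fluctuation ρ) T := hb.fluctuation
  have hfar : ε ≤ ∫ x, |fluctuation ρ x| := by
    by_contra! hlt
    have h2 := hstab θ h0 h1 (fluctuation ρ) ht hd.neg_one_le hlt
      (fun h => hρ.2 (fluctuation_eq_zero_iff.1 h))
    rw [← hd.freeEnergy_sub hW hc.even hb] at h2
    have h3 := (mul_pos_iff_of_pos_left hN).1 h2
    have h4 := hρ.1.2 _ (isAdmissible_uniform hW)
    linarith
  refine ⟨hb, (min_le_left _ _).trans ?_, ?_⟩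
  · have e : ∀ x, |uniformDensity d L x - ρ x| = N⁻¹ * |fluctuation ρ x| := fun x => by
      have : N⁻¹ * fluctuation ρ x = ρ x - uniformDensity d L x := by
        simp only [uniformDensity, fluctuation, ← hNdef]
        field_simp
      rw [abs_sub_comm, ← this, abs_mul, abs_of_pos (inv_pos.2 hN)]
    simp only [e]
    rw [integral_const_mul, div_eq_inv_mul]
    gcongr
  · have h2 := integral_entropyGap_ge ht hd.neg_one_le
    have h3 : (∫ x, entropyGap (fluctuation ρ x)) =
      N * (entropy ρ - entropy (uniformDensity d L)) := hd.integral_gap hρ.1.1.entropy_finite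
    -- Cauchy–Schwarz on a space of measure `N`, in the form of integrating
    -- $(|\eta|-\varepsilon/N)^2\ge0$.
    have h4 : ε ^ 2 / N ≤ ∫ x, fluctuation ρ x ^ 2 := by
      have i1 : Integrable fun x => 2 * (ε / N) * |fluctuation ρ x| - (ε / N) ^ 2 :=
        (ht.abs.integrable.const_mul _).sub (integrable_const _)
      have i2 := integral_mono i1 ht.integrable_sq fun x => by
        have := sq_nonneg (|fluctuation ρ x| - ε / N)
        simp only
        rw [← sq_abs (fluctuation ρ x)]
        linarith
      rw [integral_sub (ht.abs.integrable.const_mul _) (integrable_const _), integral_const_mul,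
        integral_const_torus, ← hNdef] at i2
      have h5 : 2 * (ε / N) * ε ≤ 2 * (ε / N) * ∫ x, |fluctuation ρ x| := by gcongr
      have h6 : 2 * (ε / N) * ε - N * (ε / N) ^ 2 = ε ^ 2 / N := by field_simp; ring
      linarith
    have h5 : c * (ε ^ 2 / N) ≤ N * (entropy ρ - entropy (uniformDensity d L)) := by
      rw [← h3]
      refine le_trans ?_ h2
      gcongr
    have h6 : c * (ε ^ 2 / N) / N ≤ entropy ρ - entropy (uniformDensity d L) := by
      rw [div_le_iff₀ hN]; linarith
    have := min_le_right (ε / N) (c * (ε ^ 2 / N) / N)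
    linarith

/-- The end of the uniform phase below the linear threshold: a nontrivial minimizer exists there. -/
theorem IsCoercive.exists_nontrivialMinimizer_of_isLUB (hc : IsCoercive W w) {θT Θ : ℝ}
    (hθT : IsLUB (uniformPhase W) θT) (hpos : 0 < θT) (hmem : θT ∈ uniformPhase W)
    (hlt : θT < Θ) (hΘw : 0 < 1 + Θ * w) : ∃ ρ, IsNontrivialMinimizer W θT ρ := by
  have hN := side_pow_pos d L
  have hW := hc.integrable
  obtain ⟨K, hK⟩ := hc.bounded_below
  obtain ⟨M, ε, hε, hsep⟩ := hc.exists_separation (hpos.trans hlt) hΘw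
  set u : ℕ → ℝ := fun n => θT + (Θ - θT) * (1 / ((n : ℝ) + 1)) with hu
  have hsub := sub_pos.2 hlt
  have hu1 : ∀ n, θT < u n := fun n => by
    have : 0 < (Θ - θT) * (1 / ((n : ℝ) + 1)) := by positivity
    simp only [hu]; linarith
  have hu2 : ∀ n, u n ≤ Θ := fun n => by
    have h1 : 1 / ((n : ℝ) + 1) ≤ 1 := by
      rw [div_le_one (by positivity)]
      linarith [(Nat.cast_nonneg n : (0 : ℝ) ≤ n)]
    have : (Θ - θT) * (1 / ((n : ℝ) + 1)) ≤ (Θ - θT) * 1 := by gcongr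
    simp only [hu]; linarith
  have hulim : Tendsto u atTop (𝓝 θT) := by
    have := (tendsto_one_div_add_atTop_nhds_zero_nat (𝕜 := ℝ)).const_mul (Θ - θT) |>.const_add θT
    simpa [hu] using this
  have hex : ∀ n, ∃ ρ, IsNontrivialMinimizer W (u n) ρ := fun n => by
    obtain ⟨ρ, hρ⟩ := exists_isMinimizer hW hc.even hK (hpos.trans (hu1 n)).le
    exact ⟨ρ, hρ, fun h => absurd (hθT.1 (hρ.mem_uniformPhase (hpos.trans (hu1 n)).le h))
      (not_le.2 (hu1 n))⟩
  choose ρ hρ using hex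
  have hs := fun n => hsep (u n) (hpos.trans (hu1 n)).le (hu2 n) (ρ n) (hρ n)
  obtain ⟨φ, hφ, r, s, hrd, hrb, hE, hS, hle⟩ := exists_limit_density hW ρ
    (fun n => (hρ n).1.1.isDensity) (fun n => (hs n).1)
  set E₀ := energy W (uniformDensity d L) (uniformDensity d L) with hE₀
  have hra := hrd.isAdmissible hrb hW
  have hmin : ∀ n, freeEnergy W (u n) (ρ n) ≤ freeEnergy W (u n) (uniformDensity d L) :=
    fun n => (hρ n).1.2 _ (isAdmissible_uniform hW)
  -- The entropy gap could be lost in a weak limit, but minimality turns it into an energy gap,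
  -- which survives and certifies that `r` is not uniform.
  have hEr : energy W r r ≤ E₀ - ε / (1 / 2 * Θ * L ^ d) := by
    refine le_of_tendsto' hE fun n => ?_
    have h1 := hmin (φ n)
    have h2 := (hs (φ n)).2.2
    have h3 := (hρ (φ n)).energy_lt hW (hpos.trans (hu1 (φ n))).le
    unfold freeEnergy at h1
    rw [le_sub_comm, div_le_iff₀ (by have := hpos.trans hlt; positivity)]
    have h4 : 1 / 2 * u (φ n) * L ^ d * (E₀ - energy W (ρ (φ n)) (ρ (φ n))) ≤
      1 / 2 * Θ * L ^ d * (E₀ - energy W (ρ (φ n)) (ρ (φ n))) := by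
      have h5 := sub_nonneg.2 h3.le
      have h6 := hu2 (φ n)
      gcongr
    linarith
  have hEr' : energy W r r < E₀ := by
    have : 0 < ε / (1 / 2 * Θ * L ^ d) := by have := hpos.trans hlt; positivity
    linarith
  have hlim : s + 1 / 2 * θT * L ^ d * energy W r r ≤ freeEnergy W θT (uniformDensity d L) := by
    have hu' : Tendsto (fun n => 1 / 2 * u (φ n) * L ^ d) atTop (𝓝 (1 / 2 * θT * L ^ d)) :=
      ((hulim.comp hφ.tendsto_atTop).const_mul _).mul_const _
    refine le_of_tendsto_of_tendsto' (hS.add (hu'.mul hE))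
      (tendsto_const_nhds.add (hu'.mul_const _)) fun n => hmin (φ n)
  refine ⟨r, ⟨hra, fun σ hσ => ?_⟩, fun h => hEr'.ne ?_⟩
  · refine le_trans ?_ (hmem.2 σ hσ)
    refine le_trans ?_ hlim
    unfold freeEnergy
    linarith
  · exact energy_congr h h

/-- A coercive potential for which some density beats the uniform one at the linear threshold has
a discontinuous transition, with phase coexistence, and no critical point. -/
theorem IsCoercive.discontinuous_transition (hc : IsCoercive W w)
    (htrial : ∃ ρ, IsAdmissible W ρ ∧
      freeEnergy W (-w)⁻¹ ρ < freeEnergy W (-w)⁻¹ (uniformDensity d L)) :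
    (∀ θc : ℝ, ¬ IsLowerCritical W θc) ∧
      ∃ θT : ℝ, IsDiscontinuousTransition W θT ∧ θT < (-w)⁻¹ ∧
        (∀ ρ : ℝ → Torus d L → ℝ, IsNontrivialFamily W θT ρ → ¬ MergesWithUniform θT ρ) ∧
        (∃ ρT : Torus d L → ℝ,
          ¬ ρT =ᵐ[volume] uniformDensity d L ∧
          IsMinimizer W θT ρT ∧
          IsMinimizer W θT (uniformDensity d L) ∧
          freeEnergy W θT ρT = freeEnergy W θT (uniformDensity d L) ∧
          freeEnergy W θT (uniformDensity d L) = minFreeEnergy W θT ∧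
          energy W ρT ρT < energy W (uniformDensity d L) (uniformDensity d L) ∧
          entropy (uniformDensity d L) < entropy ρT) ∧
        ¬ ContinuousAt (equilibriumEnergy W) θT ∧
        ¬ ContinuousAt (equilibriumEntropy W) θT := by
  have hN := side_pow_pos d L
  have hW := hc.integrable
  have hw := hc.neg
  obtain ⟨K, hK⟩ := hc.bounded_below
  obtain ⟨θ₁, hθ₁, hmem₁⟩ := hc.exists_pos_mem_uniformPhase
  have hnot : (-w)⁻¹ ∉ uniformPhase W := fun h => by
    obtain ⟨ρ, h1, h2⟩ := htrial
    exact absurd (h.2 ρ h1) (not_le.2 h2)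
  have hw' : 0 < (-w)⁻¹ := inv_pos.2 (neg_pos.2 hw)
  have hub : (-w)⁻¹ ∈ upperBounds (uniformPhase W) := fun θ hθ => by
    by_contra! h
    exact hnot (uniformPhase_of_le hθ hw'.le h.le)
  set θT := sSup (uniformPhase W) with hθTdef
  have hlub : IsLUB (uniformPhase W) θT := isLUB_csSup ⟨_, hmem₁⟩ ⟨_, hub⟩
  have hmem : θT ∈ uniformPhase W :=
    (isClosed_uniformPhase W).csSup_mem ⟨_, hmem₁⟩ ⟨_, hub⟩
  have hpos : 0 < θT := hθ₁.trans_le (hlub.1 hmem₁)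
  have hlt : θT < (-w)⁻¹ := (hlub.2 hub).lt_of_ne fun h => hnot (h ▸ hmem)
  -- Room strictly below the linear threshold lets the separation hold uniformly on a right
  -- neighbourhood of `θT`.
  obtain ⟨Θ, hΘ1, hΘ2⟩ := exists_between hlt
  have hΘw : 0 < 1 + Θ * w := by
    rw [lt_inv_comm₀ (hpos.trans hΘ1) (neg_pos.2 hw), ← one_div,
      lt_div_iff₀ (hpos.trans hΘ1)] at hΘ2
    linarith
  have hbelow : ∀ θ, 0 ≤ θ → θ < θT → UniformIsUniqueMinimizer W θ := fun θ h0 h1 =>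
    uniformIsUniqueMinimizer_of_lt hW hmem h0 h1
  have hnontriv : ∀ θ, θT < θ → ∀ ρ, IsMinimizer W θ ρ → IsNontrivialMinimizer W θ ρ :=
    fun θ hθ ρ hρ => ⟨hρ, fun h => absurd (hlub.1 (hρ.mem_uniformPhase (hpos.trans hθ).le h))
      (not_le.2 hθ)⟩
  have habove : ∀ θ, θT < θ → ∃ ρ, IsNontrivialMinimizer W θ ρ := fun θ hθ => by
    obtain ⟨ρ, hρ⟩ := exists_isMinimizer hW hc.even hK (hpos.trans hθ).le
    exact ⟨ρ, hnontriv θ hθ ρ hρ⟩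
  obtain ⟨ρT, hρT⟩ := hc.exists_nontrivialMinimizer_of_isLUB hlub hpos hmem hΘ1 hΘw
  have hunif := isMinimizer_uniform hW hmem
  -- A critical point below `θT` contradicts uniqueness between the two; one at or above `θT` would
  -- force uniqueness at `θT`, against coexistence.
  have hcrit : ∀ θc : ℝ, ¬ IsLowerCritical W θc := by
    intro θc h
    rcases lt_or_ge θc θT with h1 | h1
    · obtain ⟨θ, h2, h3⟩ := exists_between h1
      obtain ⟨ρ, hρ⟩ := h.above θ h2
      exact hρ.2 ((hbelow θ (h.nonneg.trans h2.le) h3).2 ρ hρ.1)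
    · exact hρT.2 ((h.below θT hpos.le h1).2 ρT hρT.1)
  obtain ⟨M, ε, hε, hsep⟩ := hc.exists_separation (hpos.trans hΘ1) hΘw
  have hE := hρT.energy_lt hW hpos.le
  have hS := hρT.1.1.isDensity.entropy_uniform_lt hρT.1.1.entropy_finite hρT.2
  have hright : ∀ᶠ θ in 𝓝[>] θT, θT < θ ∧ θ ≤ Θ :=
    (Ioc_mem_nhdsGT hΘ1)
  have hleft : ∀ᶠ θ in 𝓝[<] θT, 0 ≤ θ ∧ θ < θT :=
    (Ico_mem_nhdsLT hpos)
  refine ⟨hcrit, θT, ⟨⟨hpos, hbelow, habove⟩, hcrit θT⟩, hlt, ?_, ?_, ?_, ?_⟩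
  · intro ρ hρ h
    obtain ⟨θ, hθ, h1, h2⟩ := ((h.eventually (gt_mem_nhds hε)).and hright).exists
    exact absurd (hsep θ (hpos.trans h1).le h2 _ (hρ θ h1)).2.1 (not_le.2 hθ)
  · refine ⟨ρT, hρT.2, hρT.1, hunif,
      le_antisymm (hρT.1.2 _ (isAdmissible_uniform hW)) (hunif.2 _ hρT.1.1), ?_, hE, hS⟩
    refine (IsLeast.csInf_eq
      (s := {r | ∃ ρ, IsAdmissible W ρ ∧ r = freeEnergy W θT ρ}) ⟨⟨_, isAdmissible_uniform hW, rfl⟩, ?_⟩).symm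
    rintro _ ⟨ρ, hρ, rfl⟩
    exact hunif.2 ρ hρ
  -- The energy jumps from the left: below `θT` it takes the uniform value, while at `θT` the
  -- coexisting minimizer lies strictly lower.
  · intro hcont
    set E₀ := energy W (uniformDensity d L) (uniformDensity d L) with hE₀
    have h1 : Tendsto (equilibriumEnergy W) (𝓝[<] θT) (𝓝 (1 / 2 * θT * L ^ d * E₀)) := by
      have h2 : Tendsto (fun θ : ℝ => 1 / 2 * θ * L ^ d * E₀) (𝓝[<] θT)
          (𝓝 (1 / 2 * θT * L ^ d * E₀)) :=
        (Continuous.tendsto (by fun_prop) θT).mono_left nhdsWithin_le_nhds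
      refine h2.congr' ?_
      filter_upwards [hleft] with θ hθ
      have hu := hbelow θ hθ.1 hθ.2
      refine (IsLeast.csInf_eq
        (s := {r | ∃ ρ, IsMinimizer W θ ρ ∧ r = 1 / 2 * θ * L ^ d * energy W ρ ρ})
        ⟨⟨_, hu.1, rfl⟩, ?_⟩).symm
      rintro _ ⟨ρ, hρ, rfl⟩
      rw [energy_congr (hu.2 ρ hρ) (hu.2 ρ hρ)]
    have h3 := tendsto_nhds_unique h1 (hcont.tendsto.mono_left nhdsWithin_le_nhds)
    -- Needed because the real `sInf` of a set unbounded below is 0 by convention.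
    have hbdd : BddBelow {r | ∃ ρ, IsMinimizer W θT ρ ∧ r = 1 / 2 * θT * L ^ d * energy W ρ ρ} := by
      refine ⟨1 / 2 * θT * L ^ d * (-(∫ x, |W x|) * (M ^ 2 * L ^ d) - |E₀|), ?_⟩
      rintro _ ⟨ρ, hρ, rfl⟩
      gcongr
      have hWn : 0 ≤ ∫ x, |W x| := integral_nonneg fun _ => abs_nonneg _
      by_cases hne : ρ =ᵐ[volume] uniformDensity d L
      · rw [energy_congr hne hne]
        have : 0 ≤ (∫ x, |W x|) * (M ^ 2 * L ^ d) := by positivity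
        linarith [neg_abs_le E₀]
      · have hb := (hsep θT hpos.le hΘ1.le ρ ⟨hρ, hne⟩).1
        have h4 := neg_abs_le (energy W ρ ρ)
        have h5 := abs_energy_le hW hc.even hb
        have h6 : ∫ x, ρ x ^ 2 ≤ M ^ 2 * L ^ d := by
          rw [mul_comm, ← integral_const_torus (d := d) (L := L)]
          refine integral_mono_ae hb.integrable_sq (integrable_const _) ?_
          filter_upwards [hb.bound] with x hx
          rw [← sq_abs]
          gcongr
        have h7 := mul_le_mul_of_nonneg_left h6 hWn
        linarith [abs_nonneg E₀]
    have h4 : equilibriumEnergy W θT ≤ 1 / 2 * θT * L ^ d * energy W ρT ρT :=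
      csInf_le hbdd ⟨ρT, hρT.1, rfl⟩
    have h5 : 1 / 2 * θT * L ^ d * energy W ρT ρT < 1 / 2 * θT * L ^ d * E₀ := by gcongr
    linarith
  -- The entropy jumps from the right: at `θT` the infimum is still the uniform entropy, since the
  -- uniform density remains a minimizer, but above `θT` every minimizer has the entropy gap.
  · intro hcont
    have h1 : equilibriumEntropy W θT = entropy (uniformDensity d L) := by
      refine IsLeast.csInf_eq (s := {r | ∃ ρ, IsMinimizer W θT ρ ∧ r = entropy ρ})
        ⟨⟨_, hunif, rfl⟩, ?_⟩
      rintro _ ⟨ρ, hρ, rfl⟩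
      exact hρ.1.isDensity.entropy_uniform_le hρ.1.entropy_finite
    have h2 : ∀ᶠ θ in 𝓝[>] θT, entropy (uniformDensity d L) + ε ≤ equilibriumEntropy W θ := by
      filter_upwards [hright] with θ hθ
      obtain ⟨ρ, hρ⟩ := habove θ hθ.1
      refine le_csInf ⟨_, ρ, hρ.1, rfl⟩ ?_
      rintro _ ⟨σ, hσ, rfl⟩
      exact (hsep θ (hpos.trans hθ.1).le hθ.2 σ (hnontriv θ hθ.1 σ hσ)).2.2
    have h3 := ge_of_tendsto (hcont.tendsto.mono_left nhdsWithin_le_nhds) h2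
    linarith

end Transition

end McKeanVlasov

/-! ### Fourier analysis on the torus -/

namespace McKeanVlasov

section Fourier

variable {d : ℕ} {L : ℝ}

/-- The character `exp(i k·x)` of the torus with wave vector `k = (2π/L) n`. -/
noncomputable def character (L : ℝ) (n : Fin d → ℤ) : C(Torus d L, ℂ) where
  toFun x := ∏ i, fourier (n i) (x i)
  continuous_toFun := by fun_prop

theorem character_apply (n : Fin d → ℤ) (x : Torus d L) :
    character L n x = ∏ i, fourier (n i) (x i) := rfl

theorem norm_character_apply (n : Fin d → ℤ) (x : Torus d L) : ‖character L n x‖ = 1 := by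
  simp only [character_apply, fourier_apply, norm_prod, Circle.norm_coe, Finset.prod_const_one]

theorem character_zero (x : Torus d L) : character L (0 : Fin d → ℤ) x = 1 := by
  simp [character_apply]

theorem character_neg (n : Fin d → ℤ) (x : Torus d L) :
    character L (-n) x = (starRingEnd ℂ) (character L n x) := by
  simp only [character_apply, Pi.neg_apply, fourier_neg, map_prod]

theorem character_add (m n : Fin d → ℤ) (x : Torus d L) :
    character L (m + n) x = character L m x * character L n x := by
  simp only [character_apply, Pi.add_apply, fourier_add, ← Finset.prod_mul_distrib]

theorem character_apply_add (n : Fin d → ℤ) (x y : Torus d L) :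
    character L n (x + y) = character L n x * character L n y := by
  simp only [character_apply, fourier_apply, Pi.add_apply, smul_add, AddCircle.toCircle_add,
    Circle.coe_mul, ← Finset.prod_mul_distrib]

theorem character_apply_neg (n : Fin d → ℤ) (x : Torus d L) :
    character L n (-x) = character L (-n) x := by
  simp only [character_apply, fourier_apply, Pi.neg_apply, smul_neg, neg_smul]

theorem character_single (x : Torus d L) (i : Fin d) :
    character L (Pi.single i 1) x = fourier 1 (x i) := by
  rw [character_apply, Finset.prod_eq_single i]
  · simp
  · intro j _ hj
    simp [Pi.single_eq_of_ne hj]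
  · simp

/-- The star subalgebra of `C(𝕋, ℂ)` generated by the characters. -/
noncomputable def characterSubalgebra (d : ℕ) (L : ℝ) : StarSubalgebra ℂ C(Torus d L, ℂ) where
  toSubalgebra := Algebra.adjoin ℂ (Set.range (character (d := d) L))
  star_mem' := by
    change Algebra.adjoin ℂ (Set.range (character (d := d) L)) ≤
      star (Algebra.adjoin ℂ (Set.range (character (d := d) L)))
    refine Algebra.adjoin_le ?_
    rintro _ ⟨n, rfl⟩
    refine Algebra.subset_adjoin ⟨-n, ?_⟩
    ext1 x
    simp only [character_neg, starRingEnd_apply, ContinuousMap.star_apply]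

/-- Products of characters are characters, so their span is already an algebra. -/
theorem characterSubalgebra_coe :
    (characterSubalgebra d L).toSubalgebra.toSubmodule =
      Submodule.span ℂ (Set.range (character (d := d) L)) := by
  apply Algebra.adjoin_eq_span_of_subset
  refine .trans (fun x ↦ Submonoid.closure_induction (fun _ ↦ id) ⟨0, ?_⟩ ?_)
    Submodule.subset_span
  · ext z
    rw [character_zero, ContinuousMap.one_apply]
  · rintro _ _ _ _ ⟨m, rfl⟩ ⟨n, rfl⟩
    refine ⟨m + n, ?_⟩
    ext z
    rw [character_add, ContinuousMap.mul_apply]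

variable [hL : Fact (0 < L)]

theorem characterSubalgebra_separatesPoints : (characterSubalgebra d L).SeparatesPoints := by
  intro x y hxy
  rw [Ne, funext_iff, not_forall] at hxy
  obtain ⟨i, hi⟩ := hxy
  refine ⟨character L (Pi.single i 1),
    ⟨character L (Pi.single i 1), Algebra.subset_adjoin ⟨Pi.single i 1, rfl⟩, rfl⟩, ?_⟩
  rw [character_single, character_single, fourier_one, fourier_one]
  exact fun h => hi (AddCircle.injective_toCircle hL.out.ne' (Circle.ext h))

theorem characterSubalgebra_closure_eq_top :
    (characterSubalgebra d L).topologicalClosure = ⊤ :=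
  ContinuousMap.starSubalgebra_topologicalClosure_eq_top_of_separatesPoints _
    characterSubalgebra_separatesPoints

/-- Uniform approximation of real continuous functions by real trigonometric polynomials. -/
theorem exists_trigonometric_approx (g : C(Torus d L, ℝ)) {δ : ℝ} (hδ : 0 < δ) :
    ∃ (c : (Fin d → ℤ) →₀ ℂ) (q : C(Torus d L, ℝ)),
      (∀ x, (q x : ℂ) = ∑ n ∈ c.support, c n * character L n x) ∧ ∀ x, |g x - q x| ≤ δ := by
  set G : C(Torus d L, ℂ) := ⟨fun x => (g x : ℂ), by fun_prop⟩ with hG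
  have hmem : G ∈ (characterSubalgebra d L).topologicalClosure := by
    rw [characterSubalgebra_closure_eq_top]; trivial
  obtain ⟨P, hP, hd⟩ := Metric.mem_closure_iff.1 hmem δ hδ
  -- The real part of the approximant is again a trigonometric polynomial and is no farther from a
  -- real function.
  set Q : C(Torus d L, ℂ) := (1 / 2 : ℂ) • (P + star P) with hQ
  have hQm : Q ∈ Submodule.span ℂ (Set.range (character (d := d) L)) := by
    rw [← characterSubalgebra_coe]
    exact (characterSubalgebra d L).smul_mem (add_mem hP (star_mem hP)) _
  obtain ⟨c, hc⟩ := Finsupp.mem_span_range_iff_exists_finsupp.1 hQm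
  refine ⟨c, ⟨fun x => (P x).re, by fun_prop⟩, fun x => ?_, fun x => ?_⟩
  · have h1 : Q x = ((P x).re : ℂ) := by
      simp only [hQ, ContinuousMap.smul_apply, ContinuousMap.add_apply, ContinuousMap.star_apply,
        smul_eq_mul, Complex.star_def, Complex.add_conj]
      push_cast; ring
    rw [ContinuousMap.coe_mk, ← h1, ← hc, Finsupp.sum]
    simp [ContinuousMap.sum_apply]
  · have h1 := (ContinuousMap.dist_apply_le_dist (f := G) (g := P) x).trans hd.le
    rw [dist_eq_norm] at h1
    have h2 := (Complex.abs_re_le_norm (G x - P x)).trans h1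
    simpa [hG] using h2

/-- For nonzero `n`, translating by $L/(2n_i)$ in a coordinate with $n_i\ne0$ flips the sign of the
character but preserves the integral. -/
theorem integral_character (n : Fin d → ℤ) :
    ∫ x : Torus d L, character L n x = if n = 0 then ((L ^ d : ℝ) : ℂ) else 0 := by
  split_ifs with h
  · subst h
    simp only [character_zero]
    rw [integral_const, volume_real_torus]
    simp
  · obtain ⟨i, hi⟩ : ∃ i, n i ≠ 0 := by
      by_contra! hcon
      exact h (funext hcon)
    set y : Torus d L := Pi.single i ((L / 2 / n i : ℝ) : AddCircle L) with hy
    have hyv : character L n y = -1 := by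
      rw [character_apply, Finset.prod_eq_single i]
      · have := fourier_add_half_inv_index hi hL.out 0
        rw [zero_add, fourier_eval_zero] at this
        rw [hy, Pi.single_eq_same]
        exact this
      · intro j _ hj
        rw [hy, Pi.single_eq_of_ne hj, fourier_eval_zero]
      · simp
    have h1 : ∫ x : Torus d L, character L n (x + y) = ∫ x : Torus d L, character L n x :=
      integral_add_right_eq_self (fun x => character L n x) y
    simp only [character_apply_add, hyv, mul_neg, mul_one, integral_neg] at h1
    exact self_eq_neg.1 h1.symm

variable {W f g : Torus d L → ℝ} {C : ℝ}

theorem integrable_mul_character (hf : Integrable f) (n : Fin d → ℤ) :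
    Integrable fun x => (f x : ℂ) * character L n x :=
  hf.ofReal.mul_bdd (c := 1) (character L n).continuous.aestronglyMeasurable
    (ae_of_all _ fun x => (norm_character_apply n x).le)

/-- The Fourier coefficients of an even potential are real. -/
theorem integral_mul_character_neg (hs : ∀ x, W (-x) = W x) (n : Fin d → ℤ) :
    ∫ x, (W x : ℂ) * character L (-n) x = fourierCoefficient W n := by
  have h1 : ∫ x, (W x : ℂ) * character L n x = ∫ x, (W x : ℂ) * character L (-n) x := by
    rw [← integral_neg_eq_self]
    simp only [hs, character_apply_neg]
  have h2 : (starRingEnd ℂ) (∫ x, (W x : ℂ) * character L (-n) x) =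
      ∫ x, (W x : ℂ) * character L (-n) x := by
    conv_rhs => rw [← h1]
    rw [← integral_conj]
    simp only [map_mul, Complex.conj_ofReal, ← character_neg, neg_neg]
  rw [← Complex.conj_eq_iff_re.1 h2]
  rfl

theorem integrable_kernel_character (hW : Integrable W) (hf : IsBoundedBy f C) (n : Fin d → ℤ) :
    Integrable (fun p : Torus d L × Torus d L =>
      (W (p.1 - p.2) : ℂ) * f p.1 * character L n p.2) := by
  have h0 : Integrable (fun p : Torus d L × Torus d L => W (p.1 - p.2) * f p.1) := by
    simpa only [mul_one] using integrable_kernel hW hf (IsBoundedBy.const 1)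
  have h1 : Integrable (fun p : Torus d L × Torus d L => (((W (p.1 - p.2) * f p.1 : ℝ)) : ℂ)) :=
    h0.ofReal
  have h2 : AEStronglyMeasurable (fun p : Torus d L × Torus d L => character L n p.2) volume :=
    ((character L n).continuous.comp continuous_snd).aestronglyMeasurable
  have h3 := h1.mul_bdd (c := 1) h2 (ae_of_all _ fun p => (norm_character_apply n p.2).le)
  simpa only [Complex.ofReal_mul] using h3

/-- Characters diagonalize the energy. -/
theorem integral_kernel_character (hW : Integrable W) (hs : ∀ x, W (-x) = W x)
    (hf : IsBoundedBy f C) (n : Fin d → ℤ) :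
    ∫ p : Torus d L × Torus d L, (W (p.1 - p.2) : ℂ) * f p.1 * character L n p.2 =
      fourierCoefficient W n * ∫ x, (f x : ℂ) * character L n x := by
  rw [Measure.volume_eq_prod, integral_prod _ (integrable_kernel_character hW hf n),
    ← integral_const_mul]
  refine integral_congr_ae (ae_of_all _ fun x => ?_)
  have h1 : ∫ y, (W (x - y) : ℂ) * character L n y =
      fourierCoefficient W n * character L n x := by
    have h2 := integral_sub_left_eq_self (fun z => (W z : ℂ) * character L n (x - z)) volume x
    simp only [sub_sub_cancel] at h2
    rw [h2, ← integral_mul_character_neg hs, ← integral_mul_const]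
    congr 1
    ext y
    rw [sub_eq_add_neg x y, character_apply_add, character_apply_neg]
    ring
  calc ∫ y, (W (x - y) : ℂ) * f x * character L n y
      = f x * ∫ y, (W (x - y) : ℂ) * character L n y := by
        rw [← integral_const_mul]; congr 1; ext y; ring
    _ = _ := by rw [h1]; ring

end Fourier

end McKeanVlasov

/-! ### Real modes, coercivity and the trial density -/

namespace McKeanVlasov

section Cosine

variable {d : ℕ} {L : ℝ}

/-- The real mode `cos (k·x)`. -/
noncomputable def cosine (L : ℝ) (n : Fin d → ℤ) (x : Torus d L) : ℝ := (character L n x).re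

theorem continuous_cosine (n : Fin d → ℤ) : Continuous (cosine L n) :=
  Complex.continuous_re.comp (character L n).continuous

theorem abs_cosine_le (n : Fin d → ℤ) (x : Torus d L) : |cosine L n x| ≤ 1 :=
  (Complex.abs_re_le_norm _).trans (norm_character_apply n x).le

theorem cosine_mul (m n : Fin d → ℤ) (x : Torus d L) :
    cosine L m x * cosine L n x = 1 / 2 * cosine L (m + n) x + 1 / 2 * cosine L (m - n) x := by
  simp only [cosine, sub_eq_add_neg, character_add, character_neg, Complex.mul_re, Complex.conj_re,
    Complex.conj_im]
  ring

/-- The triad `∑ cos (kᵢ·x)`. -/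
noncomputable def triad (L : ℝ) (k : Fin 3 → Fin d → ℤ) (x : Torus d L) : ℝ :=
  ∑ i, cosine L (k i) x

theorem abs_triad_le (k : Fin 3 → Fin d → ℤ) (x : Torus d L) : |triad L k x| ≤ 3 := by
  refine (Finset.abs_sum_le_sum_abs _ _).trans ?_
  refine (Finset.sum_le_sum fun i _ => abs_cosine_le (k i) x).trans ?_
  simp

end Cosine

section Modes

variable {d : ℕ} {L : ℝ} [Fact (0 < L)] {W f g : Torus d L → ℝ} {C : ℝ} {w : ℝ}

theorem isBoundedBy_continuousMap (q : C(Torus d L, ℝ)) (h : ∀ x, |q x| ≤ C) :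
    IsBoundedBy (fun x => q x) C :=
  ⟨q.continuous.aestronglyMeasurable, ae_of_all _ h⟩

/-- The energy form on real trigonometric polynomials. -/
theorem le_energy_trigonometric (hW : Integrable W) (hs : ∀ x, W (-x) = W x)
    (hw : ∀ n, w ≤ fourierCoefficient W n) (c : (Fin d → ℤ) →₀ ℂ) (q : C(Torus d L, ℝ))
    (hq : ∀ x, (q x : ℂ) = ∑ n ∈ c.support, c n * character L n x) :
    w * ∫ x, q x ^ 2 ≤ energy W q q := by
  have hN := side_pow_pos d L
  have hb : IsBoundedBy (fun x => q x) ‖q‖ :=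
    isBoundedBy_continuousMap q fun x => q.norm_coe_le_norm x
  -- Orthogonality; `q` being real, it equals the conjugate of its expansion. Energy and $L^2$ norm
  -- then become sums over modes, compared term by term.
  have hcoef : ∀ n ∈ c.support, ∫ x, (q x : ℂ) * character L n x =
      (L ^ d : ℝ) * (starRingEnd ℂ) (c n) := by
    intro n hn
    have h1 : ∀ x, (q x : ℂ) * character L n x =
        ∑ m ∈ c.support, (starRingEnd ℂ) (c m) * character L (n - m) x := by
      intro x
      rw [← Complex.conj_ofReal (q x), hq, map_sum, Finset.sum_mul]
      refine Finset.sum_congr rfl fun m _ => ?_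
      rw [map_mul, ← character_neg, sub_eq_add_neg, character_add]
      ring
    simp only [h1]
    rw [integral_finsetSum _ fun m _ =>
      ((character L (n - m)).continuous.integrable_of_hasCompactSupport
        (HasCompactSupport.of_compactSpace _)).const_mul _]
    simp only [integral_const_mul, integral_character, sub_eq_zero]
    rw [Finset.sum_eq_single n]
    · simp; ring
    · intro m _ hm
      simp [hm.symm]
    · intro h; exact absurd hn h
  have hE : (energy W q q : ℂ) = ∑ n ∈ c.support,
      ((fourierCoefficient W n * (L ^ d * ‖c n‖ ^ 2) : ℝ) : ℂ) := by
    have h1 : (energy W q q : ℂ) = ∫ p : Torus d L × Torus d L, ∑ n ∈ c.support,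
        c n * ((W (p.1 - p.2) : ℂ) * q p.1 * character L n p.2) := by
      rw [energy, ← integral_complex_ofReal]
      congr 1
      ext p
      push_cast
      rw [hq p.2, Finset.mul_sum]
      refine Finset.sum_congr rfl fun n _ => by ring
    rw [h1, integral_finsetSum _ fun n _ => (integrable_kernel_character hW hb n).const_mul _]
    refine Finset.sum_congr rfl fun n hn => ?_
    rw [integral_const_mul, integral_kernel_character hW hs hb, hcoef n hn]
    have := Complex.mul_conj' (c n)
    push_cast
    rw [← this]
    ring
  have hL2 : ((∫ x, q x ^ 2 : ℝ) : ℂ) = ∑ n ∈ c.support, ((L ^ d * ‖c n‖ ^ 2 : ℝ) : ℂ) := by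
    have h1 : ((∫ x, q x ^ 2 : ℝ) : ℂ) = ∫ x, ∑ n ∈ c.support,
        c n * ((q x : ℂ) * character L n x) := by
      rw [← integral_complex_ofReal]
      congr 1
      ext x
      push_cast
      rw [sq]
      nth_rewrite 2 [hq x]
      rw [Finset.mul_sum]
      refine Finset.sum_congr rfl fun n _ => by ring
    rw [h1, integral_finsetSum _ fun n _ => (integrable_mul_character hb.integrable n).const_mul _]
    refine Finset.sum_congr rfl fun n hn => ?_
    rw [integral_const_mul, hcoef n hn]
    have := Complex.mul_conj' (c n)
    push_cast
    rw [← this]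
    ring
  rw [← Complex.ofReal_sum, Complex.ofReal_inj] at hE hL2
  rw [hE, hL2, Finset.mul_sum]
  refine Finset.sum_le_sum fun n _ => ?_
  exact mul_le_mul_of_nonneg_right (hw n) (by positivity)

/-- Bounded functions are `L¹` limits of bounded trigonometric polynomials. -/
theorem IsBoundedBy.exists_trigonometric_approx (hf : IsBoundedBy f C) {δ : ℝ} (hδ : 0 < δ)
    (hδ1 : δ ≤ 1) :
    ∃ (c : (Fin d → ℤ) →₀ ℂ) (q : C(Torus d L, ℝ)),
      (∀ x, (q x : ℂ) = ∑ n ∈ c.support, c n * character L n x) ∧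
      IsBoundedBy (fun x => q x) (C + 1) ∧ ∫ x, |f x - q x| ≤ δ + L ^ d * δ := by
  have hC := hf.nonneg
  obtain ⟨g, hg, hgi⟩ := hf.integrable.exists_boundedContinuous_integral_sub_le hδ
  -- Clamping to the range of `f` keeps the approximants uniformly bounded and does not increase the
  -- distance to `f`.
  set k : C(Torus d L, ℝ) := ⟨fun x => max (-C) (min C (g x)), by fun_prop⟩ with hk
  obtain ⟨c, q, hq, hkq⟩ := McKeanVlasov.exists_trigonometric_approx k hδ
  have hkC : ∀ x, |k x| ≤ C := fun x => by
    rw [abs_le]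
    exact ⟨le_max_left _ _, max_le (by linarith) (min_le_left _ _)⟩
  have hb : IsBoundedBy (fun x => q x) (C + 1) := isBoundedBy_continuousMap q fun x => by
    have h1 := abs_le.1 (hkC x)
    have h2 := abs_le.1 (hkq x)
    rw [abs_le]
    constructor <;> linarith [h1.1, h1.2, h2.1, h2.2]
  refine ⟨c, q, hq, hb, ?_⟩
  have h1 : ∫ x, |f x - q x| ≤ ∫ x, (|f x - g x| + δ) := by
    refine integral_mono_ae (hf.sub hb).abs.integrable
      ((hf.integrable.sub hgi).abs.add (integrable_const _)) ?_
    filter_upwards [hf.bound] with x hx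
    have h2 := hkq x
    have h3 : |f x - k x| ≤ |f x - g x| := by
      have h4 := abs_le.1 hx
      simp only [hk, ContinuousMap.coe_mk]
      rcases le_total C (g x) with h5 | h5
      · rw [min_eq_left h5, max_eq_right (by linarith), abs_of_nonpos (by linarith),
          abs_of_nonpos (by linarith)]
        linarith
      · rw [min_eq_right h5]
        rcases le_total (-C) (g x) with h6 | h6
        · rw [max_eq_right h6]
        · rw [max_eq_left h6, abs_of_nonneg (by linarith), abs_of_nonneg (by linarith)]
          linarith
    calc |f x - q x| ≤ |f x - k x| + |k x - q x| := abs_sub_le _ _ _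
      _ ≤ _ := add_le_add h3 h2
  rw [integral_add (integrable_fun_sub hf.integrable hgi).abs (integrable_const _), integral_const_torus] at h1
  have h2 : ∫ x, |f x - g x| ≤ δ := hg
  exact h1.trans (by gcongr)

/-- The energy is bounded below by the smallest Fourier coefficient times the `L²` norm. -/
theorem le_energy_of_le_fourierCoefficient (hW : Integrable W) (hs : ∀ x, W (-x) = W x)
    (hw : ∀ n, w ≤ fourierCoefficient W n) (hf : IsBoundedBy f C) :
    w * ∫ x, f x ^ 2 ≤ energy W f f := by
  have hN := side_pow_pos d L
  have hC := hf.nonneg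
  have hWn : 0 ≤ ∫ x, |W x| := integral_nonneg fun _ => abs_nonneg _
  -- Collects the $L^1$ Lipschitz constants of both sides and the factor in the approximation error.
  set A := 2 * (C + 1) * ((∫ x, |W x|) + |w|) * (1 + L ^ d) with hA
  have hA0 : 0 ≤ A := by positivity
  refine le_of_forall_pos_le_add fun ε hε => ?_
  have hδ : 0 < min 1 (ε / (A + 1)) := by positivity
  obtain ⟨c, q, hq, hb, hd⟩ := hf.exists_trigonometric_approx hδ (min_le_left _ _)
  set δ := min 1 (ε / (A + 1)) with hδdef
  have h1 := le_energy_trigonometric hW hs hw c q hq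
  have hf' := hf.mono (show C ≤ C + 1 by linarith)
  have h2 := abs_energy_sub_le hW hs hf' hb
  have h3 := abs_integral_sq_sub_le hf' hb
  have h4 : w * ((∫ x, f x ^ 2) - ∫ x, q x ^ 2) ≤
      |w| * (2 * (C + 1) * ∫ x, |f x - q x|) := by
    refine (le_abs_self _).trans ?_
    rw [abs_mul]
    gcongr
  have h5 : A * δ ≤ ε := by
    calc A * δ ≤ (A + 1) * (ε / (A + 1)) := by
          gcongr
          · linarith
          · exact min_le_right _ _
      _ = ε := by field_simp
  have h6 : 2 * (C + 1) * ((∫ x, |W x|) + |w|) * ∫ x, |f x - q x| ≤ A * δ := by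
    calc _ ≤ 2 * (C + 1) * ((∫ x, |W x|) + |w|) * (δ + L ^ d * δ) := by gcongr
      _ = A * δ := by rw [hA]; ring
  have h7 := neg_abs_le (energy W f f - energy W (fun x => q x) fun x => q x)
  have h8 : w * ∫ x, f x ^ 2 = w * ((∫ x, f x ^ 2) - ∫ x, q x ^ 2) + w * ∫ x, q x ^ 2 := by ring
  have h9 : energy W (fun x => q x) (fun x => q x) = energy W q q := rfl
  linarith

theorem isBoundedBy_cosine (n : Fin d → ℤ) : IsBoundedBy (cosine L n) 1 :=
  ⟨(continuous_cosine n).aestronglyMeasurable, ae_of_all _ (abs_cosine_le n)⟩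

theorem integral_cosine (n : Fin d → ℤ) :
    ∫ x, cosine L n x = if n = 0 then L ^ d else 0 := by
  have h : ∫ x, cosine L n x = (∫ x, character L n x).re := by
    have := integral_re (𝕜 := ℂ) (μ := volume) (f := fun x => character L n x)
      ((character L n).continuous.integrable_of_hasCompactSupport
        (HasCompactSupport.of_compactSpace _))
    exact this
  rw [h, integral_character]
  split_ifs
  · exact Complex.ofReal_re _
  · rfl

theorem integral_cosine_nonneg (n : Fin d → ℤ) : 0 ≤ ∫ x, cosine L n x := by
  have := side_pow_pos d L
  rw [integral_cosine]; split_ifs <;> positivity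

theorem integral_cosine_mul_mul (k l m : Fin d → ℤ) :
    ∫ x, cosine L k x * cosine L l x * cosine L m x =
      1 / 4 * ((∫ x, cosine L (k + l + m) x) + (∫ x, cosine L (k + l - m) x) +
        (∫ x, cosine L (k - l + m) x) + ∫ x, cosine L (k - l - m) x) := by
  have h : ∀ x, cosine L k x * cosine L l x * cosine L m x =
      1 / 4 * (cosine L (k + l + m) x + cosine L (k + l - m) x +
        cosine L (k - l + m) x + cosine L (k - l - m) x) := by
    intro x
    rw [cosine_mul, add_mul, mul_assoc, mul_assoc, cosine_mul, cosine_mul]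
    ring
  have i : ∀ n : Fin d → ℤ, Integrable (cosine L n) := fun n => (isBoundedBy_cosine n).integrable
  simp only [h]
  rw [integral_const_mul, integral_add (((i _).fun_add (i _)).fun_add (i _)) (i _),
    integral_add ((i _).fun_add (i _)) (i _), integral_add (i _) (i _)]

/-- Every cosine has a nonnegative integral, so accidental resonances within a triad can only help.
-/
theorem integral_cosine_mul_mul_nonneg (k l m : Fin d → ℤ) :
    0 ≤ ∫ x, cosine L k x * cosine L l x * cosine L m x := by
  rw [integral_cosine_mul_mul]
  have := integral_cosine_nonneg (L := L) (k + l + m)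
  have := integral_cosine_nonneg (L := L) (k + l - m)
  have := integral_cosine_nonneg (L := L) (k - l + m)
  have := integral_cosine_nonneg (L := L) (k - l - m)
  linarith

/-- Resonant triads have a nonzero cubic correlation. -/
theorem le_integral_cosine_mul_mul {k l m : Fin d → ℤ} (h : k + l + m = 0) :
    1 / 4 * L ^ d ≤ ∫ x, cosine L k x * cosine L l x * cosine L m x := by
  rw [integral_cosine_mul_mul, h, integral_cosine, if_pos rfl]
  have := integral_cosine_nonneg (L := L) (k + l - m)
  have := integral_cosine_nonneg (L := L) (k - l + m)
  have := integral_cosine_nonneg (L := L) (k - l - m)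
  linarith

theorem energy_cosine (hW : Integrable W) (hs : ∀ x, W (-x) = W x) (hf : IsBoundedBy f C)
    (n : Fin d → ℤ) :
    energy W f (cosine L n) = fourierCoefficient W n * ∫ x, f x * cosine L n x := by
  have h := congrArg Complex.re (integral_kernel_character hW hs hf n)
  have h1 := integral_re (𝕜 := ℂ) (integrable_kernel_character hW hf n)
  have h2 := integral_re (𝕜 := ℂ) (integrable_mul_character hf.integrable n)
  rw [Complex.re_ofReal_mul] at h
  have e1 : energy W f (cosine L n) = ∫ p : Torus d L × Torus d L,
      RCLike.re ((W (p.1 - p.2) : ℂ) * f p.1 * character L n p.2) := by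
    rw [energy]
    congr 1
    ext p
    rw [← Complex.ofReal_mul]
    exact (Complex.re_ofReal_mul _ _).symm
  have e2 : ∫ x, f x * cosine L n x = ∫ x, RCLike.re ((f x : ℂ) * character L n x) := by
    congr 1
    ext x
    exact (Complex.re_ofReal_mul _ _).symm
  rw [e1, h1, e2, h2]
  exact h

theorem isBoundedBy_triad (k : Fin 3 → Fin d → ℤ) : IsBoundedBy (triad L k) 3 :=
  ⟨(continuous_finsetSum _ fun i _ => continuous_cosine (k i)).aestronglyMeasurable,
    ae_of_all _ (abs_triad_le k)⟩

theorem integral_triad {k : Fin 3 → Fin d → ℤ} (hk : ∀ i, k i ≠ 0) : ∫ x, triad L k x = 0 := by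
  unfold triad
  rw [integral_finsetSum _ fun i _ => (isBoundedBy_cosine (k i)).integrable]
  simp [integral_cosine, hk]

/-- Each of the six orderings of the three modes contributes at least a quarter of the volume, and
all other triple products contribute nonnegatively. -/
theorem le_integral_triad_cube {k : Fin 3 → Fin d → ℤ} (hk : k 0 + k 1 + k 2 = 0) :
    3 / 2 * L ^ d ≤ ∫ x, triad L k x ^ 3 := by
  have hN := side_pow_pos d L
  have hi : ∀ i j l, Integrable fun x =>
      cosine L (k i) x * cosine L (k j) x * cosine L (k l) x := fun i j l =>
    (((isBoundedBy_cosine (k i)).mul (isBoundedBy_cosine (k j))).mul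
      (isBoundedBy_cosine (k l))).integrable
  have h : ∀ x, triad L k x ^ 3 = ∑ i, ∑ j, ∑ l,
      cosine L (k i) x * cosine L (k j) x * cosine L (k l) x := by
    intro x
    simp only [triad, Fin.sum_univ_three]
    ring
  simp only [h]
  rw [integral_finsetSum _ fun i _ => integrable_finsetSum _ fun j _ =>
    integrable_finsetSum _ fun l _ => hi i j l]
  have hb : ∀ i j l : Fin 3, (if i ≠ j ∧ j ≠ l ∧ i ≠ l then 1 / 4 * L ^ d else 0) ≤
      ∫ x, cosine L (k i) x * cosine L (k j) x * cosine L (k l) x := by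
    intro i j l
    split_ifs with hijl
    · refine le_integral_cosine_mul_mul ?_
      rw [← hk]
      revert hijl
      fin_cases i <;> fin_cases j <;> fin_cases l <;> simp <;> abel
    · exact integral_cosine_mul_mul_nonneg _ _ _
  calc 3 / 2 * L ^ d = ∑ i : Fin 3, ∑ j : Fin 3, ∑ l : Fin 3,
        (if i ≠ j ∧ j ≠ l ∧ i ≠ l then 1 / 4 * L ^ d else 0) := by
        simp [Fin.sum_univ_three]; ring
    _ ≤ _ := by
        refine Finset.sum_le_sum fun i _ => ?_
        rw [integral_finsetSum _ fun j _ => integrable_finsetSum _ fun l _ => hi i j l]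
        refine Finset.sum_le_sum fun j _ => ?_
        rw [integral_finsetSum _ fun l _ => hi i j l]
        exact Finset.sum_le_sum fun l _ => hb i j l

/-- Cosines diagonalize the energy, and each of the three correlations with the triad is at most
$3L^d$. Orthogonality of the modes is not needed, so coinciding modes do no harm. -/
theorem energy_triad_le (hW : Integrable W) (hs : ∀ x, W (-x) = W x) {k : Fin 3 → Fin d → ℤ}
    {δ : ℝ} (hδ : ∀ i, |fourierCoefficient W (k i) - w| ≤ δ) :
    energy W (triad L k) (triad L k) ≤ w * (∫ x, triad L k x ^ 2) + 9 * δ * L ^ d := by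
  have hN := side_pow_pos d L
  have ht := isBoundedBy_triad (L := L) k
  have hc := fun i => isBoundedBy_cosine (L := L) (k i)
  have h1 : energy W (triad L k) (triad L k) =
      ∑ i, fourierCoefficient W (k i) * ∫ x, triad L k x * cosine L (k i) x := by
    simp only [← energy_cosine hW hs ht]
    simp only [energy]
    rw [← integral_finsetSum _ fun i _ => integrable_kernel hW ht (hc i)]
    congr 1
    ext p
    rw [← Finset.mul_sum]
    rfl
  have h2 : ∫ x, triad L k x ^ 2 = ∑ i, ∫ x, triad L k x * cosine L (k i) x := by
    rw [← integral_finsetSum _ fun i _ => (ht.mul (hc i)).integrable]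
    congr 1
    ext x
    rw [← Finset.mul_sum, sq]
    rfl
  rw [h1, h2, Finset.mul_sum]
  have h3 : ∀ i, fourierCoefficient W (k i) * (∫ x, triad L k x * cosine L (k i) x) ≤
      w * (∫ x, triad L k x * cosine L (k i) x) + 3 * δ * L ^ d := by
    intro i
    have h4 : |∫ x, triad L k x * cosine L (k i) x| ≤ 3 * L ^ d := by
      rw [← Real.norm_eq_abs, ← volume_real_torus (d := d)]
      refine norm_integral_le_of_norm_le_const ?_
      simpa using (ht.mul (hc i)).bound
    have h5 : (fourierCoefficient W (k i) - w) * (∫ x, triad L k x * cosine L (k i) x) ≤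
        δ * (3 * L ^ d) := by
      refine (le_abs_self _).trans ?_
      rw [abs_mul]
      have := (abs_nonneg _).trans (hδ i)
      gcongr
      exact hδ i
    linarith
  calc _ ≤ ∑ i, (w * (∫ x, triad L k x * cosine L (k i) x) + 3 * δ * L ^ d) :=
        Finset.sum_le_sum fun i _ => h3 i
    _ = _ := by
      rw [Finset.sum_add_distrib]
      simp
      ring

/-- A resonant triad of nearly minimizing modes beats the uniform density at the linear threshold,
thanks to the cubic term of the entropy. -/
theorem exists_trial_density (hW : Integrable W) (hs : ∀ x, W (-x) = W x) (hw : w < 0)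
    {k : Fin 3 → Fin d → ℤ} (hk0 : ∀ i, k i ≠ 0) (hk : k 0 + k 1 + k 2 = 0)
    (hδ : ∀ i, |fourierCoefficient W (k i) - w| ≤ -w / 200000) :
    ∃ ρ, IsAdmissible W ρ ∧
      freeEnergy W (-w)⁻¹ ρ < freeEnergy W (-w)⁻¹ (uniformDensity d L) := by
  have hN := side_pow_pos d L
  set N := L ^ d with hNdef
  have ht := isBoundedBy_triad (L := L) k
  set η := triad L k with hη
  -- The amplitude must satisfy $-e/4+324e^2+9/400000<0$: cubic gain against the quartic remainder
  -- ($324=4\cdot3^4$) and the detuning of the modes from `w`.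
  obtain ⟨e, he⟩ : ∃ e : ℝ, e = 1 / 2000 := ⟨_, rfl⟩
  have hte := ht.const_mul e
  set ρ : Torus d L → ℝ := fun x => N⁻¹ * (1 + e * η x) with hρ
  have hfl : fluctuation ρ = fun x => e * η x := by
    ext x
    simp only [fluctuation, hρ, ← hNdef]
    field_simp
    ring
  have hb := ((IsBoundedBy.const (d := d) (L := L) 1).add hte).const_mul N⁻¹
  have hsmall : ∀ x, |e * η x| ≤ 1 / 2 := fun x => by
    rw [abs_mul, he, abs_of_pos (by norm_num)]
    linarith [abs_triad_le (L := L) k x]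
  have hd : IsDensity ρ := by
    refine ⟨hb.integrable, ae_of_all _ fun x => ?_, ?_⟩
    · have := (abs_le.1 (hsmall x)).1
      exact mul_nonneg (inv_pos.2 hN).le (by linarith)
    · simp only [hρ]
      rw [integral_const_mul, integral_add (integrable_const _) hte.integrable,
        integral_const_mul, integral_const_torus, hη, integral_triad hk0]
      field_simp
      simp [hNdef]
  refine ⟨ρ, hd.isAdmissible hb hW, ?_⟩
  have hfe := hd.freeEnergy_sub hW hs hb (-w)⁻¹
  rw [hfl, energy_const_mul] at hfe
  have hi2 := ht.integrable_sq
  have hi3 : Integrable fun x => η x ^ 3 := by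
    refine (((ht.mul ht).mul ht).integrable).congr (ae_of_all _ fun x => ?_)
    ring
  have hgap : ∫ x, entropyGap (e * η x) ≤
      e ^ 2 / 2 * (∫ x, η x ^ 2) - e ^ 3 / 6 * (∫ x, η x ^ 3) + N * (324 * e ^ 4) := by
    have i1 : Integrable fun x => e ^ 2 / 2 * η x ^ 2 - e ^ 3 / 6 * η x ^ 3 :=
      (hi2.const_mul _).sub (hi3.const_mul _)
    rw [← integral_const_mul, ← integral_const_mul,
      ← integral_sub (hi2.const_mul _) (hi3.const_mul _),
      ← integral_const_torus (d := d) (L := L), ← integral_add i1 (integrable_const _)]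
    refine integral_mono hte.integrable_entropyGap (i1.add (integrable_const _)) fun x => ?_
    have h1 := (abs_le.1 (abs_entropyGap_sub_le (hsmall x))).2
    have h2 : (e * η x) ^ 4 ≤ e ^ 4 * 81 := by
      rw [mul_pow]
      gcongr
      have := abs_triad_le (L := L) k x
      calc η x ^ 4 = |η x| ^ 4 := by rw [← abs_pow, abs_of_nonneg (by positivity)]
        _ ≤ 3 ^ 4 := by gcongr
        _ = 81 := by norm_num
    have e1 : (e * η x) ^ 2 = e ^ 2 * η x ^ 2 := by ring
    have e2 : (e * η x) ^ 3 = e ^ 3 * η x ^ 3 := by ring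
    rw [e1, e2] at h1
    simp only
    linarith
  have hen := energy_triad_le hW hs hδ
  have hcube := le_integral_triad_cube (L := L) hk
  rw [← hη, ← hNdef] at hen hcube
  have hw' : 0 < -w := neg_pos.2 hw
  have h1 : (-w)⁻¹ / 2 * (e * e * energy W η η) ≤
      -(e ^ 2 / 2 * ∫ x, η x ^ 2) + 9 / 400000 * e ^ 2 * N := by
    calc (-w)⁻¹ / 2 * (e * e * energy W η η)
        ≤ (-w)⁻¹ / 2 * (e * e * (w * (∫ x, η x ^ 2) + 9 * (-w / 200000) * N)) := by gcongr
      _ = _ := by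
        have hwne : w ≠ 0 := hw.ne
        field_simp
        ring
  have h2 : e ^ 3 / 6 * (3 / 2 * N) ≤ e ^ 3 / 6 * ∫ x, η x ^ 3 := by
    have : 0 ≤ e ^ 3 / 6 := by rw [he]; norm_num
    gcongr
  have h3 : N * (freeEnergy W (-w)⁻¹ ρ - freeEnergy W (-w)⁻¹ (uniformDensity d L)) < 0 := by
    rw [hfe]
    have h4 : - (e ^ 3 / 6 * (3 / 2 * N)) + N * (324 * e ^ 4) + 9 / 400000 * e ^ 2 * N < 0 := by
      have : - (e ^ 3 / 6 * (3 / 2 * N)) + N * (324 * e ^ 4) + 9 / 400000 * e ^ 2 * N =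
        N * (-(e ^ 3 / 4) + 324 * e ^ 4 + 9 / 400000 * e ^ 2) := by ring
      rw [this]
      exact mul_neg_of_pos_of_neg hN (by rw [he]; norm_num)
    linarith
  have := neg_of_mul_neg_right h3 hN.le
  linarith

end Modes

end McKeanVlasov

/-! ### The Fourier transform on the whole space and its lattice samples -/

namespace McKeanVlasov

open FourierTransform

section Lift

variable {d : ℕ} {L : ℝ}

/-- The centred cube of side `L`. -/
def centredCube (d : ℕ) (L : ℝ) : Set (EuclideanSpace ℝ (Fin d)) :=
  WithLp.ofLp ⁻¹' Set.univ.pi fun _ => Set.Ico (-(L / 2)) (-(L / 2) + L)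

theorem measurableSet_centredCube : MeasurableSet (centredCube d L) :=
  (PiLp.volume_preserving_ofLp (Fin d)).measurable
    (MeasurableSet.univ_pi fun _ => measurableSet_Ico)

variable [hL : Fact (0 < L)]

/-- The representative of a point of the torus in the centred cube. -/
noncomputable def centredLift (x : Torus d L) : EuclideanSpace ℝ (Fin d) :=
  WithLp.toLp 2 fun i => (AddCircle.equivIco L (-(L / 2)) (x i) : ℝ)

theorem measurePreserving_coe_equivIco (a : ℝ) :
    MeasurePreserving (fun x : AddCircle L => (AddCircle.equivIco L a x : ℝ)) volume
      (volume.restrict (Set.Ico a (a + L))) := by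
  have hm : Measurable fun x : AddCircle L => (AddCircle.equivIco L a x : ℝ) :=
    measurable_subtype_coe.comp (AddCircle.measurableEquivIco L a).measurable
  refine ⟨hm, ?_⟩
  have h := AddCircle.measurePreserving_mk L a
  rw [Measure.restrict_congr_set (Ico_ae_eq_Ioc (μ := volume)).symm] at h
  rw [← h.map_eq, Measure.map_map hm h.measurable]
  conv_rhs => rw [← Measure.map_id (μ := volume.restrict (Set.Ico a (a + L)))]
  refine Measure.map_congr ?_
  filter_upwards [ae_restrict_mem measurableSet_Ico] with y hy
  exact AddCircle.equivIco_coe_of_mem hy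

theorem measurePreserving_centredLift :
    MeasurePreserving (centredLift (d := d) (L := L)) volume
      (volume.restrict (centredCube d L)) := by
  have h1 : MeasurePreserving
      (fun (x : Torus d L) i => (AddCircle.equivIco L (-(L / 2)) (x i) : ℝ)) volume
      (volume.restrict (Set.univ.pi fun _ => Set.Ico (-(L / 2)) (-(L / 2) + L))) := by
    rw [volume_pi, volume_pi, Measure.restrict_pi_pi]
    exact measurePreserving_pi (fun _ => volume) _ fun _ => measurePreserving_coe_equivIco _
  have h2 := (PiLp.volume_preserving_toLp (Fin d)).restrict_preimage
    (measurableSet_centredCube (d := d) (L := L))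
  exact h2.comp h1

end Lift

section Symbol

variable {d : ℕ} {a L : ℝ} {V : EuclideanSpace ℝ (Fin d) → ℝ}

/-- The Fourier transform of the interaction on `ℝ^d`. -/
noncomputable def symbol (V : EuclideanSpace ℝ (Fin d) → ℝ) (k : EuclideanSpace ℝ (Fin d)) : ℝ :=
  (𝓕 (fun x => (V x : ℂ)) k).re

theorem continuous_symbol (hV : Integrable V) : Continuous (symbol V) := by
  refine Complex.continuous_re.comp ?_
  exact VectorFourier.fourierIntegral_continuous Real.continuous_fourierChar
    (by exact continuous_inner) hV.ofReal

/-- The Riemann–Lebesgue lemma. -/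
theorem tendsto_symbol_cocompact (V : EuclideanSpace ℝ (Fin d) → ℝ) :
    Tendsto (symbol V) (cocompact _) (𝓝 0) := by
  have h := tendsto_integral_exp_inner_smul_cocompact (fun x => (V x : ℂ))
  exact (Complex.continuous_re.tendsto 0).comp h

/-- The reflection in the hyperplane orthogonal to `k - l` exchanges the two vectors, preserves the
interaction and commutes with the Fourier transform. -/
theorem symbol_eq_of_norm_eq (hiso : IsIsotropic V) {k l : EuclideanSpace ℝ (Fin d)}
    (h : ‖k‖ = ‖l‖) : symbol V k = symbol V l := by
  set A := (Submodule.span ℝ {k - l})ᗮ.reflection with hA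
  have h1 : A k = l := Submodule.reflection_sub h
  have h2 : (fun x => (V x : ℂ)) ∘ A = fun x => (V x : ℂ) := by
    ext x
    simp only [Function.comp]
    rw [hiso (A x) x (A.norm_map x)]
  have h3 := Real.fourier_comp_linearIsometry A (fun x => (V x : ℂ)) k
  rw [h2, h1] at h3
  rw [symbol, symbol, h3]

/-- The wave vector of the mode `n`, in units in which characters are `exp(2π i k·x)`. -/
noncomputable def waveVector (L : ℝ) (n : Fin d → ℤ) : EuclideanSpace ℝ (Fin d) :=
  WithLp.toLp 2 fun i => (n i : ℝ) / L

variable [hL : Fact (0 < L)]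

theorem torusPotential_eq (x : Torus d L) : torusPotential L V x = V (centredLift x) := rfl

/-- Absolute values are needed at the endpoint $-L/2$, which is its own negative on the circle. -/
theorem abs_equivIco_neg (x : AddCircle L) :
    |(AddCircle.equivIco L (-(L / 2)) (-x) : ℝ)| = |(AddCircle.equivIco L (-(L / 2)) x : ℝ)| := by
  have hL0 : 0 < L := hL.out
  set y := (AddCircle.equivIco L (-(L / 2)) x : ℝ) with hy
  have hx : x = (y : AddCircle L) := AddCircle.coe_equivIco.symm
  have hmem : y ∈ Set.Ico (-(L / 2)) (-(L / 2) + L) := (AddCircle.equivIco L (-(L / 2)) x).2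
  rcases hmem.1.eq_or_lt with h | h
  · have : -x = (y : AddCircle L) := by
      rw [hx, ← AddCircle.coe_neg, ← h]
      have := AddCircle.coe_add_period L (-(L / 2))
      rw [← this]
      congr 1
      ring
    rw [this, AddCircle.equivIco_coe_of_mem hmem]
  · have hmem' : -y ∈ Set.Ico (-(L / 2)) (-(L / 2) + L) :=
      ⟨by linarith [hmem.2], by linarith⟩
    rw [hx, ← AddCircle.coe_neg, AddCircle.equivIco_coe_of_mem hmem', abs_neg]

/-- On boundary faces of the cube the representative of `-x` is not the negative of that of `x`, but
the norms agree, so isotropy gives evenness at every point. -/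
theorem torusPotential_neg (hiso : IsIsotropic V) (x : Torus d L) :
    torusPotential L V (-x) = torusPotential L V x := by
  refine hiso _ _ ?_
  rw [EuclideanSpace.norm_eq, EuclideanSpace.norm_eq]
  simp only [Pi.neg_apply, Real.norm_eq_abs, abs_equivIco_neg]

theorem integrable_torusPotential (hV : Integrable V) : Integrable (torusPotential L V) :=
  measurePreserving_centredLift.integrable_comp_of_integrable hV.restrict

theorem torusPotential_bounded_below (hV : IsInteraction a V) :
    ∃ K : ℝ, ∀ᵐ x, -K ≤ torusPotential L V x := by
  obtain ⟨K, hK⟩ : ∃ K : ℝ, ∀ᵐ v, -K ≤ V v := by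
    have h1 := hV.negPart_bounded.2
    rw [eLpNorm_exponent_top] at h1
    refine ⟨(eLpNormEssSup (fun x => max (-V x) 0) volume).toReal,
    (enorm_ae_le_eLpNormEssSup (fun x => max (-V x) 0) volume).mono fun v hv => ?_⟩
    have h2 := ENNReal.toReal_mono h1.ne hv
    rw [toReal_enorm, Real.norm_eq_abs] at h2
    linarith [le_abs_self (max (-V v) 0), le_max_left (-V v) 0]
  exact ⟨K, (measurePreserving_centredLift (d := d) (L := L)).quasiMeasurePreserving.ae
    (ae_restrict_of_ae hK)⟩

/-- The centred cube contains the range of the interaction, so the torus integral is the integral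
over the whole space. Tori of all admissible sides thus sample the same function. -/
theorem fourierCoefficient_torusPotential (hV : IsInteraction a V) (hLa : 2 * a < L)
    (n : Fin d → ℤ) :
    fourierCoefficient (torusPotential L V) n = symbol V (waveVector L n) := by
  have hL0 : 0 < L := hL.out
  set F : EuclideanSpace ℝ (Fin d) → ℂ :=
    fun v => Real.fourierChar (-(inner ℝ v (waveVector L n))) • (V v : ℂ) with hF
  have hFi : Integrable F := (Real.fourierIntegral_convergent_iff (waveVector L n)).2
    hV.integrable.ofReal
  have hpt : ∀ x : Torus d L, (torusPotential L V x : ℂ) * ∏ i, fourier (-(n i)) (x i) =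
      F (centredLift x) := by
    intro x
    rw [hF, torusPotential_eq, mul_comm]
    simp only [Circle.smul_def, smul_eq_mul, Real.fourierChar_apply]
    congr 1
    have h1 : ∀ i, fourier (-(n i)) (x i) =
        Complex.exp (2 * Real.pi * Complex.I * (-(n i) : ℤ) * (centredLift x i : ℝ) / L) := by
      intro i
      rw [← fourier_coe_apply]
      congr 1
      exact AddCircle.coe_equivIco.symm
    simp only [h1, ← Complex.exp_sum]
    congr 1
    rw [PiLp.inner_apply]
    simp only [waveVector, RCLike.inner_apply, conj_trivial]
    push_cast
    rw [← Finset.sum_neg_distrib, Finset.mul_sum, Finset.sum_mul]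
    refine Finset.sum_congr rfl fun i _ => ?_
    ring
  have hcube : ∀ v, v ∉ centredCube d L → F v = 0 := by
    intro v hv
    have : a < ‖v‖ := by
      simp only [centredCube, Set.mem_preimage, Set.mem_pi, Set.mem_univ, true_implies,
        not_forall] at hv
      obtain ⟨i, hi⟩ := hv
      refine lt_of_lt_of_le ?_ (PiLp.norm_apply_le v i)
      rw [Real.norm_eq_abs]
      by_contra! hcon
      have := abs_le.1 hcon
      exact hi ⟨by linarith [this.1], by linarith [this.2]⟩
    simp [hF, hV.finite_range v this]
  have hmp := measurePreserving_centredLift (d := d) (L := L)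
  have h2 : ∫ x : Torus d L, F (centredLift x) = ∫ v, F v := by
    rw [← setIntegral_eq_integral_of_forall_compl_eq_zero hcube, ← hmp.map_eq,
      integral_map hmp.measurable.aemeasurable]
    rw [hmp.map_eq]
    exact hFi.aestronglyMeasurable.restrict
  rw [fourierCoefficient, symbol, Real.fourier_eq]
  simp only [hpt]
  rw [h2]

/-- The Fourier coefficient attains its minimum when it takes a negative value. -/
theorem exists_isMinimizingMode (hV : IsInteraction a V) (hLa : 2 * a < L) {n₀ : Fin d → ℤ}
    (h₀ : fourierCoefficient (torusPotential L V) n₀ < 0) :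
    ∃ n, IsMinimizingMode (torusPotential L V) n ∧ fourierCoefficient (torusPotential L V) n < 0 := by
  have hL0 : 0 < L := hL.out
  set W := torusPotential L V with hW
  have hsym := fun n => fourierCoefficient_torusPotential (L := L) hV hLa n
  have h1 : ∀ᶠ k in cocompact (EuclideanSpace ℝ (Fin d)), fourierCoefficient W n₀ < symbol V k :=
    (tendsto_symbol_cocompact V).eventually (lt_mem_nhds h₀)
  obtain ⟨t, ht, hts⟩ := mem_cocompact.1 h1
  obtain ⟨R, hR⟩ := ht.isBounded.subset_closedBall 0
  -- Decay at infinity confines these wave vectors to a ball, which contains finitely many lattice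
  -- points.
  have hfin : {n : Fin d → ℤ | fourierCoefficient W n ≤ fourierCoefficient W n₀}.Finite := by
    refine (Set.finite_Icc (fun _ : Fin d => -⌈R * L⌉) (fun _ => ⌈R * L⌉)).subset fun n hn => ?_
    have h2 : waveVector L n ∈ t := by
      by_contra hcon
      have h3 : fourierCoefficient W n₀ < symbol V (waveVector L n) := hts hcon
      rw [← hsym] at h3
      exact absurd h3 (not_lt.2 hn)
    have h3 : ‖waveVector L n‖ ≤ R := by simpa using hR h2
    have h4 : ∀ i, |n i| ≤ ⌈R * L⌉ := by
      intro i
      have h5 := (PiLp.norm_apply_le (waveVector L n) i).trans h3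
      simp only [waveVector, Real.norm_eq_abs, abs_div, abs_of_pos hL0] at h5
      rw [div_le_iff₀ hL0] at h5
      have h6 := h5.trans (Int.le_ceil (R * L))
      exact_mod_cast h6
    exact ⟨fun i => (abs_le.1 (h4 i)).1, fun i => (abs_le.1 (h4 i)).2⟩
  obtain ⟨n, hn, hmin⟩ := Set.exists_min_image _ (fourierCoefficient W) hfin
    ⟨n₀, le_refl (fourierCoefficient W n₀)⟩
  refine ⟨n, fun m => ?_, lt_of_le_of_lt hn h₀⟩
  rcases le_total (fourierCoefficient W m) (fourierCoefficient W n₀) with h | h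
  · exact hmin m h
  · exact le_trans hn h

end Symbol

/-! ### Resonant lattice triads near a sphere -/

section Planar

variable {d : ℕ}

/-- The vector with entries `p`, `q` at the places `i`, `j`, and zero elsewhere. -/
def planar {R : Type*} [Zero R] (i j : Fin d) (p q : R) : Fin d → R :=
  fun l => if l = i then p else if l = j then q else 0

theorem norm_planar {i j : Fin d} (hij : i ≠ j) (p q : ℝ) :
    ‖(WithLp.toLp 2 (planar i j p q) : EuclideanSpace ℝ (Fin d))‖ = √(p ^ 2 + q ^ 2) := by
  rw [EuclideanSpace.norm_eq]
  congr 1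
  have h : ∀ l, ‖planar i j p q l‖ ^ 2 = (if l = i then p ^ 2 else 0) +
      if l = j then q ^ 2 else 0 := by
    intro l
    simp only [planar, Real.norm_eq_abs, sq_abs]
    by_cases h1 : l = i
    · simp [h1, hij]
    · by_cases h2 : l = j <;> simp [h1, h2, hij.symm]
  simp only [h, Finset.sum_add_distrib]
  simp

theorem tendsto_floor_div (c b : ℝ) :
    Tendsto (fun L : ℝ => ((⌊L * c⌋ : ℝ) + b) / L) atTop (𝓝 c) := by
  rw [tendsto_iff_norm_sub_tendsto_zero]
  refine squeeze_zero' (g := fun L => (1 + |b|) / L) (Eventually.of_forall fun _ => norm_nonneg _) ?_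
    (tendsto_const_nhds.div_atTop tendsto_id)
  filter_upwards [eventually_gt_atTop 0] with L hL
  rw [Real.norm_eq_abs, show ((⌊L * c⌋ : ℝ) + b) / L - c = ((⌊L * c⌋ - L * c) + b) / L by
    field_simp; ring, abs_div, abs_of_pos hL]
  gcongr
  refine (abs_add_le _ _).trans ?_
  gcongr
  rw [abs_le]
  constructor <;> linarith [Int.floor_le (L * c), Int.lt_floor_add_one (L * c)]

theorem tendsto_waveVector_planar {A B : ℝ → ℤ} {i j : Fin d} {p q : ℝ}
    (hA : Tendsto (fun L => (A L : ℝ) / L) atTop (𝓝 p))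
    (hB : Tendsto (fun L => (B L : ℝ) / L) atTop (𝓝 q)) :
    Tendsto (fun L => waveVector L (planar i j (A L) (B L))) atTop
      (𝓝 (WithLp.toLp 2 (planar i j p q))) := by
  refine ((PiLp.continuous_toLp 2 _).tendsto _).comp (tendsto_pi_nhds.2 fun l => ?_)
  simp only [planar]
  split_ifs
  · exact hA
  · exact hB
  · simp

/-- In large volume there is a resonant triad of modes close to a given sphere of wave vectors. -/
theorem exists_resonant_triads {V : EuclideanSpace ℝ (Fin d) → ℝ} (hd : 2 ≤ d)
    (hV : Integrable V) (hiso : IsIsotropic V) (κ : EuclideanSpace ℝ (Fin d)) {δ : ℝ}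
    (hδ : 0 < δ) :
    ∀ᶠ L : ℝ in atTop, ∃ k : Fin 3 → Fin d → ℤ, (∀ i, k i ≠ 0) ∧ k 0 + k 1 + k 2 = 0 ∧
      ∀ i, |symbol V (waveVector L (k i)) - symbol V κ| ≤ δ := by
  set i : Fin d := ⟨0, by omega⟩ with hi
  set j : Fin d := ⟨1, by omega⟩ with hj
  have hij : i ≠ j := by simp [hi, hj]
  set r := ‖κ‖ with hr
  have hr0 : 0 ≤ r := norm_nonneg _
  have h3 : √3 ^ 2 = (3 : ℝ) := Real.sq_sqrt (by norm_num)
  -- Rounded multiples of $(r,0)$ and $(-r/2,r\sqrt3/2)$; the third mode is minus their sum, so the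
  -- resonance is exact. The added 1 here and in `B₁` keeps all modes nonzero even when `r = 0`,
  -- that is, when the minimum lies at the origin.
  set A₀ : ℝ → ℤ := fun L => ⌊L * r⌋ + 1 with hA₀
  set A₁ : ℝ → ℤ := fun L => ⌊L * (-(r / 2))⌋ with hA₁
  set B₁ : ℝ → ℤ := fun L => ⌊L * (r * (√3 / 2))⌋ + 1 with hB₁
  have tA₀ : Tendsto (fun L => (A₀ L : ℝ) / L) atTop (𝓝 r) := by
    simpa [hA₀] using tendsto_floor_div r 1
  have tA₁ : Tendsto (fun L => (A₁ L : ℝ) / L) atTop (𝓝 (-(r / 2))) := by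
    simpa [hA₁] using tendsto_floor_div (-(r / 2)) 0
  have tB₁ : Tendsto (fun L => (B₁ L : ℝ) / L) atTop (𝓝 (r * (√3 / 2))) := by
    simpa [hB₁] using tendsto_floor_div (r * (√3 / 2)) 1
  have tA₂ : Tendsto (fun L => ((-(A₀ L + A₁ L) : ℤ) : ℝ) / L) atTop (𝓝 (-(r + -(r / 2)))) := by
    refine (tA₀.add tA₁).neg.congr fun L => ?_
    push_cast; ring
  have tB₂ : Tendsto (fun L => ((-B₁ L : ℤ) : ℝ) / L) atTop (𝓝 (-(r * (√3 / 2)))) := by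
    refine tB₁.neg.congr fun L => ?_
    push_cast; ring
  have t0 : Tendsto (fun L : ℝ => ((0 : ℤ) : ℝ) / L) atTop (𝓝 0) := by simp
  have hnear : ∀ {A B : ℝ → ℤ} {p q : ℝ}, Tendsto (fun L => (A L : ℝ) / L) atTop (𝓝 p) →
      Tendsto (fun L => (B L : ℝ) / L) atTop (𝓝 q) → p ^ 2 + q ^ 2 = r ^ 2 →
      ∀ᶠ L in atTop, |symbol V (waveVector L (planar i j (A L) (B L))) - symbol V κ| ≤ δ := by
    intro A B p q hA hB hpq
    have h1 : symbol V κ = symbol V (WithLp.toLp 2 (planar i j p q)) := by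
      refine symbol_eq_of_norm_eq hiso ?_
      rw [norm_planar hij, hpq, Real.sqrt_sq hr0]
    rw [h1]
    have h2 := ((continuous_symbol hV).tendsto _).comp
      (tendsto_waveVector_planar (i := i) (j := j) hA hB)
    filter_upwards [Metric.tendsto_nhds.1 h2 δ hδ] with L hL
    exact hL.le
  filter_upwards [hnear tA₀ t0 (by ring), hnear tA₁ tB₁ (by linear_combination r ^ 2 / 4 * h3),
    hnear tA₂ tB₂ (by linear_combination r ^ 2 / 4 * h3), eventually_ge_atTop 0]
    with L h0 h1 h2 hL
  have hA0 : 0 < A₀ L := by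
    have : 0 ≤ ⌊L * r⌋ := Int.floor_nonneg.2 (by positivity)
    simp only [hA₀]; omega
  have hB0 : 0 < B₁ L := by
    have : 0 ≤ ⌊L * (r * (√3 / 2))⌋ := Int.floor_nonneg.2 (by positivity)
    simp only [hB₁]; omega
  refine ⟨![planar i j (A₀ L) 0, planar i j (A₁ L) (B₁ L),
    planar i j (-(A₀ L + A₁ L)) (-B₁ L)], fun l => ?_, ?_, fun l => ?_⟩
  · fin_cases l
    · exact fun h => hA0.ne' (by simpa [planar] using congrFun h i)
    · exact fun h => hB0.ne' (by simpa [planar, hij.symm] using congrFun h j)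
    · exact fun h => hB0.ne' (by simpa [planar, hij.symm] using congrFun h j)
  · ext l
    change planar i j (A₀ L) 0 l + planar i j (A₁ L) (B₁ L) l +
      planar i j (-(A₀ L + A₁ L)) (-B₁ L) l = 0
    simp only [planar]
    split_ifs <;> ring
  · fin_cases l
    · exact h0
    · exact h1
    · exact h2

end Planar

end McKeanVlasov

/-! ### The transition in large volume -/

theorem mainTheorem1 (d : ℕ) (hd : 2 ≤ d) (a : ℝ) (V : EuclideanSpace ℝ (Fin d) → ℝ)
    (hV : IsInteraction a V) (hiso : IsIsotropic V)
    (hneg : ∃ (L₀ : ℝ) (_ : Fact (0 < L₀)), 2 * a < L₀ ∧ HasNegativeMode (torusPotential L₀ V)) :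
    ∃ L₁ : ℝ, ∀ (L : ℝ) [Fact (0 < L)], L₁ ≤ L →
      (∀ θc : ℝ, ¬ IsLowerCritical (torusPotential L V) θc) ∧
      ∃ θT : ℝ, IsDiscontinuousTransition (torusPotential L V) θT ∧
        (∃ n : Fin d → ℤ, IsMinimizingMode (torusPotential L V) n ∧
          fourierCoefficient (torusPotential L V) n < 0 ∧
          θT < |fourierCoefficient (torusPotential L V) n|⁻¹) ∧
        (∀ ρ : ℝ → Torus d L → ℝ, IsNontrivialFamily (torusPotential L V) θT ρ →
          ¬ MergesWithUniform θT ρ) ∧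
        (∃ ρT : Torus d L → ℝ,
          ¬ ρT =ᵐ[volume] uniformDensity d L ∧
          IsMinimizer (torusPotential L V) θT ρT ∧
          IsMinimizer (torusPotential L V) θT (uniformDensity d L) ∧
          freeEnergy (torusPotential L V) θT ρT =
            freeEnergy (torusPotential L V) θT (uniformDensity d L) ∧
          freeEnergy (torusPotential L V) θT (uniformDensity d L) =
            minFreeEnergy (torusPotential L V) θT ∧
          energy (torusPotential L V) ρT ρT <
            energy (torusPotential L V) (uniformDensity d L) (uniformDensity d L) ∧
          entropy (uniformDensity d L) < entropy ρT) ∧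
        ¬ ContinuousAt (equilibriumEnergy (torusPotential L V)) θT ∧
        ¬ ContinuousAt (equilibriumEntropy (torusPotential L V)) θT := by
  obtain ⟨L₀, hL₀, haL₀, n₀, hn₀⟩ := hneg
  rw [fourierCoefficient_torusPotential hV haL₀] at hn₀
  -- The minimum is taken over all of $\mathbb R^d$, so `w` and the required precision of the triad
  -- do not depend on `L`.
  obtain ⟨κ, hκ⟩ := (continuous_symbol hV.integrable).exists_forall_le' (waveVector L₀ n₀)
    (((tendsto_symbol_cocompact V).eventually (lt_mem_nhds hn₀)).mono fun _ h => h.le)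
  set w := symbol V κ with hwdef
  have hw : w < 0 := (hκ _).trans_lt hn₀
  obtain ⟨L₁, hL₁⟩ := eventually_atTop.1 (exists_resonant_triads hd hV.integrable hiso κ
    (δ := -w / 200000) (by linarith))
  refine ⟨max L₁ (2 * a + 1), fun L _ hL => ?_⟩
  have haL : 2 * a < L := by linarith [(le_max_right _ _).trans hL]
  obtain ⟨k, hk0, hk, hkw⟩ := hL₁ L ((le_max_left _ _).trans hL)
  have hsym := fun n => fourierCoefficient_torusPotential (L := L) hV haL n
  have hle : ∀ n, w ≤ fourierCoefficient (torusPotential L V) n := fun n => by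
    rw [hsym]; exact hκ _
  have hWi := integrable_torusPotential (L := L) hV.integrable
  have hWs := torusPotential_neg (L := L) hiso
  have hc : IsCoercive (torusPotential L V) w := ⟨hWi, hWs, torusPotential_bounded_below hV, hw,
    fun _ _ hf => le_energy_of_le_fourierCoefficient hWi hWs hle hf⟩
  have htrial := exists_trial_density hWi hWs hw hk0 hk fun i => by rw [hsym]; exact hkw i
  obtain ⟨hcrit, θT, hdisc, hlt, hrest⟩ := hc.discontinuous_transition htrial
  -- The hypothesis gives a negative coefficient only at side `L₀`; at side `L` a mode of the triad
  -- supplies one, being close to `w`.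
  obtain ⟨n, hmin, hnneg⟩ := exists_isMinimizingMode (L := L) (n₀ := k 0) hV haL (by
    rw [hsym]
    have := (abs_le.1 (hkw 0)).2
    linarith)
  refine ⟨hcrit, θT, hdisc, ⟨n, hmin, hnneg, hlt.trans_le ?_⟩, hrest⟩
  rw [abs_of_neg hnneg]
  exact inv_anti₀ (neg_pos.2 hnneg) (neg_le_neg (hle n))
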